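/- Let $n\ge 1$, let $\Omega\subsetneq\mathbb R^n$ be a domain (a nonempty, open, connected proper subset), and write $d(z,\partial\Omega)$ for the Euclidean distance from $z$ to $\partial\Omega$. For a rectifiable curve $\gamma$ in $\Omega$ (a continuous map of a compact interval into $\Omega$ with finite Euclidean length) let $l_Q(\gamma)=\int_\gamma \frac{|dz|}{d(z,\partial\Omega)}$ be its quasihyperbolic length, the integral being with respect to arc length. For $x,y\in\Omega$ let $d_Q(x,y)=\inf l_Q(\gamma)$, the infimum being over all rectifiable curves $\gamma$ in $\Omega$ from $x$ to $y$. A quasihyperbolic geodesic from $x$ to $y$ is a rectifiable curve $\gamma$ in $\Omega$ from $x$ to $y$ with $l_Q(\gamma)=d_Q(x,y)$. A set $G\subset\mathbb R^n$ is called strictly convex if for any two distinct points $y,z\in\overline G$ the open segment between $y$ and $z$ lies in the interior of $G$. Then the following hold. (i) For every $x\in\Omega$ and $0<r\le\frac1{100}$, both the open quasihyperbolic ball $B_Q(x,r)=\{y\in\Omega: d_Q(x,y)<r\}$ and the closed quasihyperbolic ball $\{y\in\Omega: d_Q(x,y)\le r\}$ are strictly convex. (ii) If $x,y\in\Omega$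 and $d_Q(x,y)<\frac1{50}$, then there is exactly one quasihyperbolic geodesic from $x$ to $y$, up to parametrization. Precisely, with $L=d_Q(x,y)$ there is a quasihyperbolic geodesic $\gamma_0:[0,L]\to\Omega$ from $x$ to $y$ that is parametrized by quasihyperbolic length, i.e. $l_Q(\gamma_0|_{[s,t]})=t-s$ for $0\le s\le t\le L$, and every quasihyperbolic geodesic $\gamma:[a,b]\to\Omega$ from $x$ to $y$ has the form $\gamma=\gamma_0\circ\varphi$ with $\varphi:[a,b]\to[0,L]$ continuous, nondecreasing and onto. The constants $\frac1{100}$ and $\frac1{50}$ depend neither on $n$ nor on $\Omega$. -/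

import Mathlib

open Set MeasureTheory
open scoped ENNReal

namespace Quasihyperbolic

noncomputable section

variable {n : ℕ}

/-- A domain: a nonempty, open and connected subset of `ℝⁿ`. -/
def IsDomainSet (Ω : Set (EuclideanSpace ℝ (Fin n))) : Prop :=
  IsOpen Ω ∧ IsConnected Ω

/-- `γ` restricted to `[a, b]` is a rectifiable curve in `Ω` from `x` to `y`: it is continuous
and of finite Euclidean length. -/
structure IsRectifiableCurve (Ω : Set (EuclideanSpace ℝ (Fin n)))
    (γ : ℝ → EuclideanSpace ℝ (Fin n)) (a b : ℝ) (x y : EuclideanSpace ℝ (Fin n)) : Prop where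
  le : a ≤ b
  continuousOn : ContinuousOn γ (Icc a b)
  rectifiable : BoundedVariationOn γ (Icc a b)
  mapsTo : MapsTo γ (Icc a b) Ω
  left : γ a = x
  right : γ b = y

/-- The line integral `∫_γ |dz| / d(z, ∂Ω)` over the restriction of `γ` to `[a, b]`, computed in
the parametrization of this restriction by Euclidean arc length
(`eVariationOn γ (Icc a b)` is its Euclidean length). It is used for rectifiable curves in a
proper subdomain `Ω`, on which `d(z, ∂Ω)` is positive. -/
def qhLength (Ω : Set (EuclideanSpace ℝ (Fin n))) (γ : ℝ → EuclideanSpace ℝ (Fin n))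
    (a b : ℝ) : ℝ≥0∞ :=
  ∫⁻ s in Icc 0 (eVariationOn γ (Icc a b)).toReal,
    ENNReal.ofReal (1 / Metric.infDist (naturalParameterization γ (Icc a b) a s) (frontier Ω))

/-- The quasihyperbolic distance: the infimum of the quasihyperbolic lengths of the rectifiable
curves in `Ω` from `x` to `y`. -/
def qhDist (Ω : Set (EuclideanSpace ℝ (Fin n))) (x y : EuclideanSpace ℝ (Fin n)) : ℝ≥0∞ :=
  sInf {l : ℝ≥0∞ | ∃ (γ : ℝ → EuclideanSpace ℝ (Fin n)) (a b : ℝ),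
    IsRectifiableCurve Ω γ a b x y ∧ l = qhLength Ω γ a b}

/-- The open quasihyperbolic ball of centre `x` and radius `r`. -/
def qhBall (Ω : Set (EuclideanSpace ℝ (Fin n))) (x : EuclideanSpace ℝ (Fin n)) (r : ℝ) :
    Set (EuclideanSpace ℝ (Fin n)) :=
  {y | y ∈ Ω ∧ qhDist Ω x y < ENNReal.ofReal r}

/-- The closed quasihyperbolic ball of centre `x` and radius `r`. -/
def qhClosedBall (Ω : Set (EuclideanSpace ℝ (Fin n))) (x : EuclideanSpace ℝ (Fin n)) (r : ℝ) :
    Set (EuclideanSpace ℝ (Fin n)) :=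
  {y | y ∈ Ω ∧ qhDist Ω x y ≤ ENNReal.ofReal r}

/-- A set `G` is strictly convex if the open segment between any two distinct points of its
closure lies in its interior. -/
def IsStrictlyConvex (G : Set (EuclideanSpace ℝ (Fin n))) : Prop :=
  ∀ y ∈ closure G, ∀ z ∈ closure G, y ≠ z → openSegment ℝ y z ⊆ interior G

/-- `γ` restricted to `[a, b]` is a quasihyperbolic geodesic in `Ω` from `x` to `y`: a rectifiable
curve of quasihyperbolic length `d_Q(x, y)`. The parametrization is arbitrary. -/
def IsGeodesic (Ω : Set (EuclideanSpace ℝ (Fin n))) (γ : ℝ → EuclideanSpace ℝ (Fin n))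
    (a b : ℝ) (x y : EuclideanSpace ℝ (Fin n)) : Prop :=
  IsRectifiableCurve Ω γ a b x y ∧ qhLength Ω γ a b = qhDist Ω x y

/-- A quasihyperbolic geodesic `γ : [0, d_Q(x, y)] → Ω` from `x` to `y` in its canonical
parametrization, the one by quasihyperbolic length. -/
def IsCanonicalGeodesic (Ω : Set (EuclideanSpace ℝ (Fin n)))
    (γ : ℝ → EuclideanSpace ℝ (Fin n)) (x y : EuclideanSpace ℝ (Fin n)) : Prop :=
  IsGeodesic Ω γ 0 (qhDist Ω x y).toReal x y ∧
    ∀ s t : ℝ, 0 ≤ s → s ≤ t → t ≤ (qhDist Ω x y).toReal →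
      qhLength Ω γ s t = ENNReal.ofReal (t - s)

/-- `γ` on `[a, b]` is obtained from `γ₀` on `[0, L]` by a continuous nondecreasing change of
parameter from `[a, b]` onto `[0, L]`. -/
def IsReparametrization (γ : ℝ → EuclideanSpace ℝ (Fin n)) (a b : ℝ)
    (γ₀ : ℝ → EuclideanSpace ℝ (Fin n)) (L : ℝ) : Prop :=
  ∃ φ : ℝ → ℝ, ContinuousOn φ (Icc a b) ∧ MonotoneOn φ (Icc a b) ∧ φ a = 0 ∧ φ b = L ∧
    ∀ t ∈ Icc a b, γ t = γ₀ (φ t)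

end

end Quasihyperbolic

/-! The convexity rests on one estimate: if `y` and `z` lie within quasihyperbolic distance `ρ ≤
1/40` of `x`, then `(1 - l) y + l z` lies within `√(ρ² - l(1-l)‖y-z‖²/(4d²))`, where `d` is the
distance from `x` to the boundary (`qhDist_convexComb_le`). To get it, join `x` to `y` and to `z` by
chains `a`, `b` with the same number of equally short steps, and measure the chain `m = (1-l)a +
lb`. With `h = a - b`, the convex combination identity for squared norms yields a gain `l(1-l)‖Δh‖²`
in `‖Δm‖²`. The squared distance to the boundary is semiconcave (`sq_infDist_convexComb_ge`), so
replacing the boundary distances at `a` and `b` by the one at `m` costs only a multiple of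
`l(1-l)‖h‖²`. Since `h` starts at `0`, a discrete Poincaré inequality bounds `‖h‖²` by the sum of
the `‖Δh‖²`, and for small `ρ` the gain wins (`sq_sum_div_infDist_le`). Refining the chains removes
the discretization error.

Geodesics follow from strict convexity. If two different points both lay at distances at most `s`
from `x` and `t` from `y`, with `s + t = d_Q(x, y)`, their midpoint would be strictly closer to both
ends, against the triangle inequality (`eq_of_between`). Such a point exists by compactness
(`exists_between`). These points, indexed by `s`, form the canonical geodesic, and every geodesic
must pass through them. -/

namespace Quasihyperbolic

/-! ### Arc length along a continuous curve of bounded variation -/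

section ArcLength

variable {E : Type*} [MetricSpace E] {γ : ℝ → E} {a b c : ℝ}

lemma variationOnFromTo_Icc {t : ℝ} (ht : t ∈ Icc a b) :
    variationOnFromTo γ (Icc a b) a t = (eVariationOn γ (Icc a t)).toReal := by
  rw [variationOnFromTo.eq_of_le _ _ ht.1, Icc_inter_Icc, max_self, min_eq_right ht.2]

lemma toReal_eVariationOn_add (hab : a ≤ b) (hbc : b ≤ c) (hv : BoundedVariationOn γ (Icc a c)) :
    (eVariationOn γ (Icc a b)).toReal + (eVariationOn γ (Icc b c)).toReal =
      (eVariationOn γ (Icc a c)).toReal := by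
  have h := eVariationOn.Icc_add_Icc γ (s := univ) hab hbc (mem_univ b)
  simp only [univ_inter] at h
  rw [← h, ENNReal.toReal_add]
  · exact hv.mono (Icc_subset_Icc_right hbc)
  · exact hv.mono (Icc_subset_Icc_left hab)

/-- A one-sided jump of the variation function equals the jump of `γ` on that side, hence vanishes
for continuous `γ`; the two sides and the point itself are then glued. -/
lemma continuousOn_variationOnFromTo {s : Set ℝ} (hc : ContinuousOn γ s)
    (hv : LocallyBoundedVariationOn γ s) (ha : a ∈ s) :
    ContinuousOn (variationOnFromTo γ s a) s := by
  intro t ht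
  have hs : s = {t} ∪ (s ∩ Iio t) ∪ (s ∩ Ioi t) := by
    ext u
    rcases lt_trichotomy u t with h | h | h <;> grind
  have hl := variationOnFromTo.tendsto_left ha ht hv ((hc t ht).mono inter_subset_left)
  have hr := variationOnFromTo.tendsto_right ha ht hv ((hc t ht).mono inter_subset_left)
  simp only [dist_self, sub_zero, add_zero] at hl hr
  have key : ContinuousWithinAt (variationOnFromTo γ s a)
      ({t} ∪ (s ∩ Iio t) ∪ (s ∩ Ioi t)) t :=
    (continuousWithinAt_singleton.union hl).union hr
  rwa [← hs] at key

lemma continuousOn_toReal_eVariationOn (hab : a ≤ b) (hc : ContinuousOn γ (Icc a b))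
    (hv : BoundedVariationOn γ (Icc a b)) :
    ContinuousOn (fun t => (eVariationOn γ (Icc a t)).toReal) (Icc a b) :=
  (continuousOn_variationOnFromTo hc hv.locallyBoundedVariationOn (left_mem_Icc.2 hab)).congr
    fun _ ht => (variationOnFromTo_Icc ht).symm

lemma exists_toReal_eVariationOn_eq (hab : a ≤ b) (hc : ContinuousOn γ (Icc a b))
    (hv : BoundedVariationOn γ (Icc a b)) {s : ℝ}
    (hs : s ∈ Icc 0 (eVariationOn γ (Icc a b)).toReal) :
    ∃ t ∈ Icc a b, (eVariationOn γ (Icc a t)).toReal = s := by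
  have h := intermediate_value_Icc hab (continuousOn_toReal_eVariationOn hab hc hv)
  have h0 : (eVariationOn γ (Icc a a)).toReal = 0 := by simp [eVariationOn.subsingleton]
  simp only [h0] at h
  exact h hs

lemma naturalParameterization_toReal_eVariationOn (hv : BoundedVariationOn γ (Icc a b)) {t : ℝ}
    (ht : t ∈ Icc a b) :
    naturalParameterization γ (Icc a b) a (eVariationOn γ (Icc a t)).toReal = γ t := by
  have h := edist_naturalParameterization_eq_zero hv.locallyBoundedVariationOn
    (left_mem_Icc.2 (ht.1.trans ht.2)) ht
  rwa [edist_eq_zero, variationOnFromTo_Icc ht] at h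

end ArcLength

/-! ### Quasihyperbolic length: additivity, invariance and bounds -/

section QhLength

variable {n : ℕ} {Ω : Set (EuclideanSpace ℝ (Fin n))} {γ : ℝ → EuclideanSpace ℝ (Fin n)}
  {a b c : ℝ}

/-- Any function that inverts the arc length function of a curve computes its quasihyperbolic
length. -/
lemma qhLength_eq_of_forall (hab : a ≤ b) (hc : ContinuousOn γ (Icc a b))
    (hv : BoundedVariationOn γ (Icc a b)) {f : ℝ → EuclideanSpace ℝ (Fin n)}
    (hf : ∀ t ∈ Icc a b, f (eVariationOn γ (Icc a t)).toReal = γ t) :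
    qhLength Ω γ a b = ∫⁻ s in Icc 0 (eVariationOn γ (Icc a b)).toReal,
      ENNReal.ofReal (1 / Metric.infDist (f s) (frontier Ω)) := by
  refine setLIntegral_congr_fun measurableSet_Icc fun s hs => ?_
  obtain ⟨t, ht, rfl⟩ := exists_toReal_eVariationOn_eq hab hc hv hs
  simp only [naturalParameterization_toReal_eVariationOn hv ht, hf t ht]

lemma qhLength_add (hab : a ≤ b) (hbc : b ≤ c) (hc : ContinuousOn γ (Icc a c))
    (hv : BoundedVariationOn γ (Icc a c)) :
    qhLength Ω γ a c = qhLength Ω γ a b + qhLength Ω γ b c := by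
  have h1 : Icc a b ⊆ Icc a c := Icc_subset_Icc_right hbc
  have h2 : Icc b c ⊆ Icc a c := Icc_subset_Icc_left hab
  set f := naturalParameterization γ (Icc a c) a with hf
  set V := (eVariationOn γ (Icc a b)).toReal with hV
  set W := (eVariationOn γ (Icc b c)).toReal with hW
  have hV0 : 0 ≤ V := ENNReal.toReal_nonneg
  have hW0 : 0 ≤ W := ENNReal.toReal_nonneg
  have e1 : qhLength Ω γ a b = ∫⁻ s in Icc 0 V,
      ENNReal.ofReal (1 / Metric.infDist (f s) (frontier Ω)) :=
    qhLength_eq_of_forall hab (hc.mono h1) (hv.mono h1) fun t ht =>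
      naturalParameterization_toReal_eVariationOn hv (h1 ht)
  have e2 : qhLength Ω γ b c = ∫⁻ s in Icc 0 W,
      ENNReal.ofReal (1 / Metric.infDist (f (s + V)) (frontier Ω)) := by
    refine qhLength_eq_of_forall hbc (hc.mono h2) (hv.mono h2) (f := fun s => f (s + V))
      fun t ht => ?_
    have := toReal_eVariationOn_add hab ht.1 (hv.mono (Icc_subset_Icc_right ht.2))
    rw [add_comm, this]
    exact naturalParameterization_toReal_eVariationOn hv (h2 ht)
  have e3 : qhLength Ω γ a c = ∫⁻ s in Icc 0 (V + W),
      ENNReal.ofReal (1 / Metric.infDist (f s) (frontier Ω)) := by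
    rw [toReal_eVariationOn_add hab hbc hv]; rfl
  -- The second piece is read off the arc length parametrization of the whole curve, shifted by the
  -- length `V` of the first piece.
  have e4 : ∫⁻ s in Icc 0 W, ENNReal.ofReal (1 / Metric.infDist (f (s + V)) (frontier Ω)) =
      ∫⁻ s in Icc V (V + W), ENNReal.ofReal (1 / Metric.infDist (f s) (frontier Ω)) := by
    have hpre : Icc 0 W = (fun s : ℝ => s + V) ⁻¹' Icc V (V + W) := by
      ext s; simp
    rw [hpre]
    exact (measurePreserving_add_right volume V).setLIntegral_comp_preimage_emb
      (measurableEmbedding_addRight V)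
      (fun s => ENNReal.ofReal (1 / Metric.infDist (f s) (frontier Ω))) _
  rw [e1, e2, e3, e4, ← Icc_union_Ioc_eq_Icc (b := V) hV0 (by linarith),
    lintegral_union measurableSet_Ioc, setLIntegral_congr (Ioc_ae_eq_Icc (a := V))]
  exact Set.disjoint_left.2 fun s hs hs' => absurd hs.2 (not_le.2 hs'.1)

lemma eVariationOn_comp_sub_right (γ : ℝ → EuclideanSpace ℝ (Fin n)) (c a t : ℝ) :
    eVariationOn (fun u => γ (u - c)) (Icc (a + c) t) = eVariationOn γ (Icc a (t - c)) := by
  have h := eVariationOn.comp_eq_of_monotoneOn γ (t := Icc (a + c) t) (fun u => u - c)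
    (fun u _ v _ h => by simpa using h)
  simpa [Function.comp_def] using h

lemma eVariationOn_comp_neg (γ : ℝ → EuclideanSpace ℝ (Fin n)) (a b : ℝ) :
    eVariationOn (fun u => γ (-u)) (Icc a b) = eVariationOn γ (Icc (-b) (-a)) := by
  have h := eVariationOn.comp_eq_of_antitoneOn γ (t := Icc a b) (fun u => -u)
    (fun u _ v _ h => by simpa using h)
  simpa [Function.comp_def] using h

lemma continuousOn_comp_sub_right (hc : ContinuousOn γ (Icc a b)) (c : ℝ) :
    ContinuousOn (fun u => γ (u - c)) (Icc (a + c) (b + c)) :=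
  hc.comp (by fun_prop) fun u hu => ⟨by linarith [hu.1], by linarith [hu.2]⟩

lemma continuousOn_comp_neg (hc : ContinuousOn γ (Icc a b)) :
    ContinuousOn (fun u => γ (-u)) (Icc (-b) (-a)) :=
  hc.comp (by fun_prop) fun u hu => ⟨by linarith [hu.2], by linarith [hu.1]⟩

lemma qhLength_comp_sub_right (hab : a ≤ b) (hc : ContinuousOn γ (Icc a b))
    (hv : BoundedVariationOn γ (Icc a b)) (c : ℝ) :
    qhLength Ω (fun u => γ (u - c)) (a + c) (b + c) = qhLength Ω γ a b := by
  rw [qhLength_eq_of_forall (f := naturalParameterization γ (Icc a b) a) (by linarith)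
    (continuousOn_comp_sub_right hc c), eVariationOn_comp_sub_right, add_sub_cancel_right]
  · rfl
  · rwa [BoundedVariationOn, eVariationOn_comp_sub_right, add_sub_cancel_right]
  · intro t ht
    rw [eVariationOn_comp_sub_right]
    exact naturalParameterization_toReal_eVariationOn hv
      ⟨by linarith [ht.1], by linarith [ht.2]⟩

lemma qhLength_comp_neg (hab : a ≤ b) (hc : ContinuousOn γ (Icc a b))
    (hv : BoundedVariationOn γ (Icc a b)) :
    qhLength Ω (fun u => γ (-u)) (-b) (-a) = qhLength Ω γ a b := by
  set V := (eVariationOn γ (Icc a b)).toReal with hV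
  set f := naturalParameterization γ (Icc a b) a with hf
  rw [qhLength_eq_of_forall (f := fun s => f (V - s)) (by linarith)
    (continuousOn_comp_neg hc), eVariationOn_comp_neg, neg_neg, neg_neg]
  · have hpre : Icc 0 V = (fun s : ℝ => V - s) ⁻¹' Icc 0 V := by
      ext s; simp
    rw [← hV]
    conv_lhs => rw [hpre]
    exact (Measure.measurePreserving_sub_left volume V).setLIntegral_comp_preimage_emb
      (MeasurableEquiv.subLeft V).measurableEmbedding
      (fun s => ENNReal.ofReal (1 / Metric.infDist (f s) (frontier Ω))) _
  · rwa [BoundedVariationOn, eVariationOn_comp_neg, neg_neg, neg_neg]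
  · intro t ht
    have ht' : -t ∈ Icc a b := ⟨by linarith [ht.2], by linarith [ht.1]⟩
    rw [eVariationOn_comp_neg, neg_neg, hV, ← toReal_eVariationOn_add ht'.1 ht'.2 hv,
      add_sub_cancel_right]
    exact naturalParameterization_toReal_eVariationOn hv ht'

lemma qhLength_congr {γ' : ℝ → EuclideanSpace ℝ (Fin n)} (hab : a ≤ b)
    (hc : ContinuousOn γ (Icc a b)) (hv : BoundedVariationOn γ (Icc a b))
    (h : EqOn γ γ' (Icc a b)) : qhLength Ω γ a b = qhLength Ω γ' a b := by
  have hv' : BoundedVariationOn γ' (Icc a b) := by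
    rwa [BoundedVariationOn, ← eVariationOn.congr h]
  rw [qhLength_eq_of_forall (f := naturalParameterization γ' (Icc a b) a) hab hc hv,
    eVariationOn.congr h]
  · rfl
  · intro t ht
    rw [eVariationOn.congr (h.mono (Icc_subset_Icc_right ht.2)), h ht]
    exact naturalParameterization_toReal_eVariationOn hv' ht

lemma qhLength_le (hab : a ≤ b) (hc : ContinuousOn γ (Icc a b))
    (hv : BoundedVariationOn γ (Icc a b)) {m : ℝ} (hm : 0 < m)
    (h : ∀ t ∈ Icc a b, m ≤ Metric.infDist (γ t) (frontier Ω)) :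
    qhLength Ω γ a b ≤ ENNReal.ofReal ((eVariationOn γ (Icc a b)).toReal / m) := by
  calc qhLength Ω γ a b
      ≤ ∫⁻ _ in Icc 0 (eVariationOn γ (Icc a b)).toReal, ENNReal.ofReal (1 / m) := by
        refine setLIntegral_mono' measurableSet_Icc fun s hs => ?_
        obtain ⟨t, ht, rfl⟩ := exists_toReal_eVariationOn_eq hab hc hv hs
        rw [naturalParameterization_toReal_eVariationOn hv ht]
        exact ENNReal.ofReal_le_ofReal (one_div_le_one_div_of_le hm (h t ht))
    _ = _ := by
        rw [setLIntegral_const, Real.volume_Icc, ← ENNReal.ofReal_mul (by positivity)]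
        congr 1; ring

lemma qhLength_self (Ω : Set (EuclideanSpace ℝ (Fin n))) (γ : ℝ → EuclideanSpace ℝ (Fin n))
    (a : ℝ) : qhLength Ω γ a a = 0 := by
  simp [qhLength, eVariationOn.subsingleton]

lemma dist_le_toReal_eVariationOn (hab : a ≤ b) (hv : BoundedVariationOn γ (Icc a b)) :
    dist (γ a) (γ b) ≤ (eVariationOn γ (Icc a b)).toReal :=
  hv.dist_le (left_mem_Icc.2 hab) (right_mem_Icc.2 hab)

/-- The lower bound of the quasihyperbolic length by the Euclidean distance of the end points. -/
lemma log_le_qhLength (hab : a ≤ b) (hc : ContinuousOn γ (Icc a b))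
    (hv : BoundedVariationOn γ (Icc a b))
    (hpos : ∀ t ∈ Icc a b, 0 < Metric.infDist (γ t) (frontier Ω)) :
    ENNReal.ofReal (Real.log (1 + dist (γ a) (γ b) / Metric.infDist (γ a) (frontier Ω))) ≤
      qhLength Ω γ a b := by
  set d := Metric.infDist (γ a) (frontier Ω) with hd
  have hd0 : 0 < d := hpos a (left_mem_Icc.2 hab)
  set V := (eVariationOn γ (Icc a b)).toReal with hV
  have hV0 : 0 ≤ V := ENNReal.toReal_nonneg
  -- After arc length `s` the boundary distance is at most `d + s`, so this integral bounds the
  -- quasihyperbolic length from below.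
  have hint : ∫ s in (0 : ℝ)..V, (d + s)⁻¹ = Real.log (1 + V / d) := by
    rw [intervalIntegral.integral_comp_add_left (fun s => s⁻¹), integral_inv_of_pos] <;>
      try positivity
    congr 1; field_simp
    ring
  have hcont : ContinuousOn (fun s => (d + s)⁻¹) (Icc 0 V) :=
    ContinuousOn.inv₀ (by fun_prop) fun s hs => by have := hs.1; positivity
  calc ENNReal.ofReal (Real.log (1 + dist (γ a) (γ b) / d))
      ≤ ENNReal.ofReal (Real.log (1 + V / d)) := by
        refine ENNReal.ofReal_le_ofReal (Real.log_le_log (by positivity) ?_)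
        gcongr
        exact dist_le_toReal_eVariationOn hab hv
    _ = ∫⁻ s in Icc 0 V, ENNReal.ofReal ((d + s)⁻¹) := by
        rw [← hint, intervalIntegral.integral_of_le hV0, ← integral_Icc_eq_integral_Ioc,
          ofReal_integral_eq_lintegral_ofReal hcont.integrableOn_Icc]
        refine (ae_restrict_iff' measurableSet_Icc).2 (.of_forall fun s hs => ?_)
        have := hs.1
        simp only [Pi.zero_apply]
        positivity
    _ ≤ qhLength Ω γ a b := by
        refine setLIntegral_mono' measurableSet_Icc fun s hs => ?_
        obtain ⟨t, ht, rfl⟩ := exists_toReal_eVariationOn_eq hab hc hv hs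
        rw [naturalParameterization_toReal_eVariationOn hv ht, ← one_div]
        refine ENNReal.ofReal_le_ofReal (one_div_le_one_div_of_le (hpos t ht) ?_)
        have h1 := Metric.infDist_le_infDist_add_dist (s := frontier Ω) (x := γ t) (y := γ a)
        have h2 := dist_le_toReal_eVariationOn ht.1 (hv.mono (Icc_subset_Icc_right ht.2))
        rw [dist_comm] at h1
        linarith

end QhLength

/-! ### Distance to the boundary -/

section BoundaryDistance

variable {n : ℕ} {Ω : Set (EuclideanSpace ℝ (Fin n))} {p q z : EuclideanSpace ℝ (Fin n)}

lemma infDist_frontier_pos (ho : IsOpen Ω) (hne : (frontier Ω).Nonempty) (hz : z ∈ Ω) :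
    0 < Metric.infDist z (frontier Ω) :=
  (isClosed_frontier.notMem_iff_infDist_pos hne).1 fun h => by
    rw [ho.frontier_eq] at h
    exact h.2 hz

/-- The ball is connected and misses the frontier, so it cannot meet both `Ω` and the complement of
its closure. -/
lemma ball_infDist_frontier_subset (ho : IsOpen Ω) (hz : z ∈ Ω) :
    Metric.ball z (Metric.infDist z (frontier Ω)) ⊆ Ω := by
  rcases (Metric.infDist_nonneg (x := z) (s := frontier Ω)).eq_or_lt with h0 | h0
  · simp [← h0]
  refine (convex_ball z _).isPreconnected.subset_left_of_subset_union ho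
    (isClosed_closure (s := Ω)).isOpen_compl ?_ ?_ ⟨z, Metric.mem_ball_self h0, hz⟩
  · exact disjoint_compl_right.mono_left subset_closure
  · intro w hw
    by_contra hcon
    simp only [mem_union, mem_compl_iff, not_or, not_not] at hcon
    have hf : w ∈ frontier Ω := by
      rw [ho.frontier_eq]; exact ⟨hcon.2, hcon.1⟩
    have := Metric.infDist_le_dist_of_mem (x := z) hf
    rw [Metric.mem_ball, dist_comm] at hw
    linarith

lemma infDist_frontier_le_add (p q : EuclideanSpace ℝ (Fin n)) :
    Metric.infDist q (frontier Ω) ≤ Metric.infDist p (frontier Ω) + dist p q := by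
  have := Metric.infDist_le_infDist_add_dist (s := frontier Ω) (x := q) (y := p)
  rwa [dist_comm] at this

lemma exists_infDist_frontier_ge {γ : ℝ → EuclideanSpace ℝ (Fin n)} {a b : ℝ} (ho : IsOpen Ω)
    (hne : (frontier Ω).Nonempty) (hc : ContinuousOn γ (Icc a b)) (hm : MapsTo γ (Icc a b) Ω) :
    ∃ m > 0, ∀ t ∈ Icc a b, m ≤ Metric.infDist (γ t) (frontier Ω) := by
  rcases (Icc a b).eq_empty_or_nonempty with he | he
  · exact ⟨1, one_pos, by simp [he]⟩
  obtain ⟨t, ht, hmin⟩ := isCompact_Icc.exists_isMinOn he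
    ((Metric.continuous_infDist_pt (frontier Ω)).comp_continuousOn hc)
  exact ⟨_, infDist_frontier_pos ho hne (hm ht), fun u hu => hmin hu⟩

end BoundaryDistance

/-! ### Operations on rectifiable curves -/

section Curves

variable {n : ℕ} {Ω : Set (EuclideanSpace ℝ (Fin n))} {γ γ' : ℝ → EuclideanSpace ℝ (Fin n)}
  {a b c d s t : ℝ} {x y z : EuclideanSpace ℝ (Fin n)}

lemma IsRectifiableCurve.restrict (h : IsRectifiableCurve Ω γ a b x y) (hs : a ≤ s) (hst : s ≤ t)
    (ht : t ≤ b) : IsRectifiableCurve Ω γ s t (γ s) (γ t) :=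
  have hsub : Icc s t ⊆ Icc a b := Icc_subset_Icc hs ht
  ⟨hst, h.continuousOn.mono hsub, h.rectifiable.mono hsub, h.mapsTo.mono_left hsub, rfl, rfl⟩

lemma IsRectifiableCurve.comp_neg (h : IsRectifiableCurve Ω γ a b x y) :
    IsRectifiableCurve Ω (fun u => γ (-u)) (-b) (-a) y x where
  le := neg_le_neg h.le
  continuousOn := continuousOn_comp_neg h.continuousOn
  rectifiable := by
    rw [BoundedVariationOn, eVariationOn_comp_neg, neg_neg, neg_neg]
    exact h.rectifiable
  mapsTo := fun u hu => h.mapsTo ⟨by linarith [hu.2], by linarith [hu.1]⟩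
  left := by simpa using h.right
  right := by simpa using h.left

lemma IsRectifiableCurve.comp_sub_right (h : IsRectifiableCurve Ω γ a b x y) (c : ℝ) :
    IsRectifiableCurve Ω (fun u => γ (u - c)) (a + c) (b + c) x y where
  le := by linarith [h.le]
  continuousOn := continuousOn_comp_sub_right h.continuousOn c
  rectifiable := by
    rw [BoundedVariationOn, eVariationOn_comp_sub_right, add_sub_cancel_right]
    exact h.rectifiable
  mapsTo := fun u hu => h.mapsTo ⟨by linarith [hu.1], by linarith [hu.2]⟩
  left := by simpa using h.left
  right := by simpa using h.right

lemma IsRectifiableCurve.congr (h : IsRectifiableCurve Ω γ a b x y)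
    (he : EqOn γ γ' (Icc a b)) : IsRectifiableCurve Ω γ' a b x y where
  le := h.le
  continuousOn := h.continuousOn.congr he.symm
  rectifiable := by
    rw [BoundedVariationOn, ← eVariationOn.congr he]
    exact h.rectifiable
  mapsTo := h.mapsTo.congr he
  left := by rw [← he (left_mem_Icc.2 h.le), h.left]
  right := by rw [← he (right_mem_Icc.2 h.le), h.right]

lemma IsRectifiableCurve.qhLength_add (h : IsRectifiableCurve Ω γ a b x y) (hs : a ≤ s)
    (ht : s ≤ b) : qhLength Ω γ a b = qhLength Ω γ a s + qhLength Ω γ s b :=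
  Quasihyperbolic.qhLength_add hs ht h.continuousOn h.rectifiable

lemma IsRectifiableCurve.union (h : IsRectifiableCurve Ω γ a b x y)
    (h' : IsRectifiableCurve Ω γ b c y z) : IsRectifiableCurve Ω γ a c x z where
  le := h.le.trans h'.le
  continuousOn := by
    rw [← Icc_union_Icc_eq_Icc h.le h'.le]
    exact h.continuousOn.union_of_isClosed h'.continuousOn isClosed_Icc isClosed_Icc
  rectifiable := by
    have := eVariationOn.Icc_add_Icc γ (s := univ) h.le h'.le (mem_univ b)
    simp only [univ_inter] at this
    rw [BoundedVariationOn, ← this]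
    exact ENNReal.add_ne_top.2 ⟨h.rectifiable, h'.rectifiable⟩
  mapsTo := by
    rw [← Icc_union_Icc_eq_Icc h.le h'.le]
    exact h.mapsTo.union h'.mapsTo
  left := h.left
  right := h'.right

/-- Concatenation of rectifiable curves. -/
lemma IsRectifiableCurve.exists_concat (h : IsRectifiableCurve Ω γ a b x y)
    (h' : IsRectifiableCurve Ω γ' c d y z) :
    ∃ (σ : ℝ → EuclideanSpace ℝ (Fin n)) (e : ℝ), IsRectifiableCurve Ω σ a e x z ∧
      qhLength Ω σ a e = qhLength Ω γ a b + qhLength Ω γ' c d := by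
  classical
  set τ : ℝ → EuclideanSpace ℝ (Fin n) := fun u => γ' (u - (b - c)) with hτ
  have h2 := h'.comp_sub_right (b - c)
  rw [add_sub_cancel] at h2
  set σ : ℝ → EuclideanSpace ℝ (Fin n) := fun u => if u ≤ b then γ u else τ u with hσ
  have e1 : EqOn γ σ (Icc a b) := fun u hu => by simp [hσ, hu.2]
  have e2 : EqOn τ σ (Icc b (d + (b - c))) := fun u hu => by
    rcases hu.1.eq_or_lt with rfl | hlt
    · simp only [hσ, le_refl, if_true]
      rw [h.right]
      exact h2.left
    · simp [hσ, not_le.2 hlt]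
  have c1 := h.congr e1
  have c2 := h2.congr e2
  refine ⟨σ, d + (b - c), c1.union c2, ?_⟩
  rw [(c1.union c2).qhLength_add c1.le c2.le,
    ← qhLength_congr h.le h.continuousOn h.rectifiable e1,
    ← qhLength_congr h2.le h2.continuousOn h2.rectifiable e2]
  congr 1
  have := qhLength_comp_sub_right (Ω := Ω) h'.le h'.continuousOn h'.rectifiable (b - c)
  rwa [add_sub_cancel] at this

lemma IsRectifiableCurve.left_mem (h : IsRectifiableCurve Ω γ a b x y) : x ∈ Ω :=
  h.left ▸ h.mapsTo (left_mem_Icc.2 h.le)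

lemma IsRectifiableCurve.right_mem (h : IsRectifiableCurve Ω γ a b x y) : y ∈ Ω :=
  h.right ▸ h.mapsTo (right_mem_Icc.2 h.le)

lemma IsRectifiableCurve.qhLength_ne_top (ho : IsOpen Ω) (hne : (frontier Ω).Nonempty)
    (h : IsRectifiableCurve Ω γ a b x y) : qhLength Ω γ a b ≠ ⊤ := by
  obtain ⟨m, hm, hle⟩ := exists_infDist_frontier_ge ho hne h.continuousOn h.mapsTo
  exact ne_top_of_le_ne_top ENNReal.ofReal_ne_top
    (qhLength_le h.le h.continuousOn h.rectifiable hm hle)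

lemma IsRectifiableCurve.toReal_qhLength_add (ho : IsOpen Ω) (hne : (frontier Ω).Nonempty)
    (h : IsRectifiableCurve Ω γ a b x y) (hs : a ≤ s) (hst : s ≤ t) (ht : t ≤ b) :
    (qhLength Ω γ a t).toReal = (qhLength Ω γ a s).toReal + (qhLength Ω γ s t).toReal := by
  have h1 := h.restrict le_rfl (hs.trans hst) ht
  rw [h1.qhLength_add hs hst, ENNReal.toReal_add
    ((h1.restrict le_rfl hs hst).qhLength_ne_top ho hne)
    ((h1.restrict hs hst le_rfl).qhLength_ne_top ho hne)]

lemma IsRectifiableCurve.monotoneOn_toReal_qhLength (ho : IsOpen Ω) (hne : (frontier Ω).Nonempty)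
    (h : IsRectifiableCurve Ω γ a b x y) :
    MonotoneOn (fun u => (qhLength Ω γ a u).toReal) (Icc a b) := fun u hu v hv huv => by
  simp only [h.toReal_qhLength_add ho hne hu.1 huv hv.2]
  exact le_add_of_nonneg_right ENNReal.toReal_nonneg

/-- On the compact curve the boundary distance has a positive lower bound `m`, so increments of
quasihyperbolic length are at most `1 / m` times those of arc length, which is continuous. -/
lemma IsRectifiableCurve.continuousOn_toReal_qhLength (ho : IsOpen Ω)
    (hne : (frontier Ω).Nonempty) (h : IsRectifiableCurve Ω γ a b x y) :
    ContinuousOn (fun u => (qhLength Ω γ a u).toReal) (Icc a b) := by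
  obtain ⟨m, hm, hle⟩ := exists_infDist_frontier_ge ho hne h.continuousOn h.mapsTo
  have hV := continuousOn_toReal_eVariationOn h.le h.continuousOn h.rectifiable
  have key : ∀ u ∈ Icc a b, ∀ v ∈ Icc a b, u ≤ v →
      dist (qhLength Ω γ a u).toReal (qhLength Ω γ a v).toReal ≤
        dist (eVariationOn γ (Icc a u)).toReal (eVariationOn γ (Icc a v)).toReal / m := by
    intro u hu v hv huv
    have h1 := h.restrict hu.1 huv hv.2
    rw [h.toReal_qhLength_add ho hne hu.1 huv hv.2, ← toReal_eVariationOn_add hu.1 huv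
      (h.rectifiable.mono (Icc_subset_Icc_right hv.2)), dist_self_add_right, dist_self_add_right,
      Real.norm_of_nonneg ENNReal.toReal_nonneg, Real.norm_of_nonneg ENNReal.toReal_nonneg]
    exact ENNReal.toReal_le_of_le_ofReal (by positivity)
      (qhLength_le huv h1.continuousOn h1.rectifiable hm fun w hw =>
        hle w ⟨hu.1.trans hw.1, hw.2.trans hv.2⟩)
  intro t ht
  have ht0 := tendsto_iff_dist_tendsto_zero.1 (hV t ht)
  refine tendsto_iff_dist_tendsto_zero.2 (squeeze_zero' (.of_forall fun _ => dist_nonneg) ?_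
    (by simpa using ht0.div_const m))
  filter_upwards [self_mem_nhdsWithin] with u hu
  rcases le_total u t with hut | hut
  · exact key u hu t ht hut
  · have := key t ht u hu hut
    rwa [dist_comm, dist_comm (eVariationOn γ (Icc a t)).toReal] at this

end Curves

/-! ### Quasihyperbolic distance and its comparison with Euclidean distance -/

section Distance

variable {n : ℕ} {Ω : Set (EuclideanSpace ℝ (Fin n))} {γ : ℝ → EuclideanSpace ℝ (Fin n)}
  {a b : ℝ} {x y z p q : EuclideanSpace ℝ (Fin n)}

lemma IsRectifiableCurve.qhDist_le (h : IsRectifiableCurve Ω γ a b x y) :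
    qhDist Ω x y ≤ qhLength Ω γ a b :=
  sInf_le ⟨γ, a, b, h, rfl⟩

lemma exists_curve_of_qhDist_lt {l : ℝ≥0∞} (h : qhDist Ω x y < l) :
    ∃ (γ : ℝ → EuclideanSpace ℝ (Fin n)) (a b : ℝ),
      IsRectifiableCurve Ω γ a b x y ∧ qhLength Ω γ a b < l := by
  obtain ⟨_, ⟨γ, a, b, hγ, rfl⟩, hl⟩ := sInf_lt_iff.1 h
  exact ⟨γ, a, b, hγ, hl⟩

lemma qhDist_comm_le (x y : EuclideanSpace ℝ (Fin n)) : qhDist Ω y x ≤ qhDist Ω x y := by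
  refine le_sInf ?_
  rintro _ ⟨γ, a, b, hγ, rfl⟩
  rw [← qhLength_comp_neg hγ.le hγ.continuousOn hγ.rectifiable]
  exact hγ.comp_neg.qhDist_le

lemma qhDist_comm (x y : EuclideanSpace ℝ (Fin n)) : qhDist Ω x y = qhDist Ω y x :=
  le_antisymm (qhDist_comm_le y x) (qhDist_comm_le x y)

lemma qhDist_triangle (x y z : EuclideanSpace ℝ (Fin n)) :
    qhDist Ω x z ≤ qhDist Ω x y + qhDist Ω y z := by
  -- Truncated subtraction isolates one distance at a time, so that each infimum can be tested on a
  -- single curve.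
  rw [← tsub_le_iff_left]
  refine le_sInf ?_
  rintro _ ⟨γ', c, d, hγ', rfl⟩
  rw [tsub_le_iff_left, ← tsub_le_iff_right]
  refine le_sInf ?_
  rintro _ ⟨γ, a, b, hγ, rfl⟩
  obtain ⟨σ, e, hσ, hl⟩ := hγ.exists_concat hγ'
  rw [tsub_le_iff_right, ← hl]
  exact hσ.qhDist_le

lemma eVariationOn_Icc_le_of_lipschitzOnWith {K : NNReal} (h : LipschitzOnWith K γ (Icc a b)) :
    eVariationOn γ (Icc a b) ≤ ENNReal.ofReal (K * (b - a)) := by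
  have := h.comp_eVariationOn_le (mapsTo_id (Icc a b))
  rwa [eVariationOn_id_Icc, Function.comp_id, ← ENNReal.ofReal_coe_nnreal,
    ← ENNReal.ofReal_mul K.coe_nonneg] at this

/-- The straight segment is a competitor; along it the boundary distance drops by at most `dist p
q`. -/
lemma qhDist_le_of_dist_lt (ho : IsOpen Ω) (hp : p ∈ Ω)
    (h : dist p q < Metric.infDist p (frontier Ω)) :
    qhDist Ω p q ≤ ENNReal.ofReal (dist p q / (Metric.infDist p (frontier Ω) - dist p q)) := by
  set γ : ℝ → EuclideanSpace ℝ (Fin n) :=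
    ⇑(AffineMap.lineMap p q : ℝ →ᵃ[ℝ] EuclideanSpace ℝ (Fin n)) with hγ
  have hlip : LipschitzWith (nndist p q) γ := lipschitzWith_lineMap p q
  have hvar := eVariationOn_Icc_le_of_lipschitzOnWith (a := 0) (b := 1) (hlip.lipschitzOnWith)
  simp only [sub_zero, mul_one, coe_nndist] at hvar
  have hdist : ∀ t ∈ Icc (0 : ℝ) 1, dist p (γ t) ≤ dist p q := fun t ht => by
    rw [hγ, dist_left_lineMap, Real.norm_of_nonneg ht.1]
    exact mul_le_of_le_one_left dist_nonneg ht.2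
  have hcurve : IsRectifiableCurve Ω γ 0 1 p q :=
    { le := zero_le_one
      continuousOn := hlip.continuous.continuousOn
      rectifiable := ne_top_of_le_ne_top ENNReal.ofReal_ne_top hvar
      mapsTo := fun t ht => ball_infDist_frontier_subset ho hp <| by
        rw [Metric.mem_ball, dist_comm]; exact (hdist t ht).trans_lt h
      left := by simp [hγ]
      right := by simp [hγ] }
  refine hcurve.qhDist_le.trans ((qhLength_le zero_le_one hcurve.continuousOn hcurve.rectifiable
    (sub_pos.2 h) fun t ht => ?_).trans (ENNReal.ofReal_le_ofReal ?_))
  · have h1 := infDist_frontier_le_add (Ω := Ω) (γ t) p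
    have h2 := hdist t ht
    rw [dist_comm] at h1
    linarith
  · have := sub_pos.2 h
    gcongr
    exact ENNReal.toReal_le_of_le_ofReal dist_nonneg hvar

lemma qhDist_self (ho : IsOpen Ω) (hne : (frontier Ω).Nonempty) (hp : p ∈ Ω) :
    qhDist Ω p p = 0 := by
  have := qhDist_le_of_dist_lt (q := p) ho hp (by simpa using infDist_frontier_pos ho hne hp)
  simpa using this

lemma dist_le_of_qhDist_le (ho : IsOpen Ω) (hne : (frontier Ω).Nonempty) (hp : p ∈ Ω)
    {r : ℝ} (hr : 0 ≤ r) (h : qhDist Ω p q ≤ ENNReal.ofReal r) :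
    dist p q ≤ Metric.infDist p (frontier Ω) * (Real.exp r - 1) := by
  have hd := infDist_frontier_pos ho hne hp
  have h1 : ENNReal.ofReal (Real.log (1 + dist p q / Metric.infDist p (frontier Ω))) ≤
      qhDist Ω p q := by
    refine le_sInf ?_
    rintro _ ⟨γ, a, b, hγ, rfl⟩
    have := log_le_qhLength hγ.le hγ.continuousOn hγ.rectifiable
      fun t ht => infDist_frontier_pos ho hne (hγ.mapsTo ht)
    rwa [hγ.left, hγ.right] at this
  have h2 := (ENNReal.ofReal_le_ofReal_iff hr).1 (h1.trans h)
  rw [Real.log_le_iff_le_exp (by positivity)] at h2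
  rw [mul_comm, ← div_le_iff₀ hd]
  linarith

lemma qhDist_lt_top_mem (h : qhDist Ω x y < ⊤) : x ∈ Ω ∧ y ∈ Ω := by
  obtain ⟨γ, a, b, hγ, -⟩ := exists_curve_of_qhDist_lt h
  exact ⟨hγ.left_mem, hγ.right_mem⟩

lemma qhDist_eq_zero (ho : IsOpen Ω) (hne : (frontier Ω).Nonempty) (h : qhDist Ω p q = 0) :
    p = q := by
  have hp := (qhDist_lt_top_mem (h.trans_lt ENNReal.zero_lt_top)).1
  have := dist_le_of_qhDist_le ho hne hp le_rfl (h.trans_le zero_le)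
  simpa using this

/-- A point of a curve of length less than `s + t` divides it into curves of lengths less than
`s` and `t`. -/
lemma exists_qhDist_lt_of_lt_add (ho : IsOpen Ω) (hne : (frontier Ω).Nonempty) {s t : ℝ}
    (hs : 0 < s) (ht : 0 < t) (h : qhDist Ω x y < ENNReal.ofReal (s + t)) :
    ∃ p ∈ Ω, qhDist Ω x p < ENNReal.ofReal s ∧ qhDist Ω p y < ENNReal.ofReal t := by
  obtain ⟨γ, a, b, hγ, hl⟩ := exists_curve_of_qhDist_lt h
  have hlt := (ENNReal.lt_ofReal_iff_toReal_lt (hγ.qhLength_ne_top ho hne)).1 hl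
  set ℓ := (qhLength Ω γ a b).toReal with hℓ
  have hℓ0 : 0 ≤ ℓ := ENNReal.toReal_nonneg
  -- The cut must come at a length below `s` and above `ℓ - t`: take the middle of `ℓ - t` and `min
  -- s ℓ`, cut off at `0`.
  have hτ : max 0 ((ℓ - t + min s ℓ) / 2) ∈ Icc 0 ℓ :=
    ⟨le_max_left _ _, max_le hℓ0 (by linarith [min_le_right s ℓ])⟩
  have hivt := intermediate_value_Icc hγ.le (hγ.continuousOn_toReal_qhLength ho hne)
  simp only [qhLength_self, ENNReal.toReal_zero] at hivt
  obtain ⟨u, hu, hu'⟩ := hivt hτ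
  simp only at hu'
  have hadd := hγ.toReal_qhLength_add ho hne hu.1 hu.2 le_rfl
  have c1 := hγ.restrict le_rfl hu.1 hu.2
  have c2 := hγ.restrict hu.1 hu.2 le_rfl
  have d1 := c1.qhDist_le
  have d2 := c2.qhDist_le
  rw [hγ.left] at d1
  rw [hγ.right] at d2
  refine ⟨γ u, hγ.mapsTo hu, d1.trans_lt ?_, d2.trans_lt ?_⟩
  · rw [ENNReal.lt_ofReal_iff_toReal_lt (c1.qhLength_ne_top ho hne), hu']
    exact max_lt hs (by linarith [min_le_left s ℓ])
  · rw [ENNReal.lt_ofReal_iff_toReal_lt (c2.qhLength_ne_top ho hne)]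
    have h1 := le_max_right 0 ((ℓ - t + min s ℓ) / 2)
    rw [← hℓ] at hadd
    rw [← hu'] at h1
    rcases min_cases s ℓ with ⟨h2, -⟩ | ⟨h2, -⟩ <;> rw [h2] at h1 <;> linarith

lemma exists_chain (ho : IsOpen Ω) (hne : (frontier Ω).Nonempty) {η : ℝ} (hη : 0 < η) (N : ℕ)
    {x y : EuclideanSpace ℝ (Fin n)} (hx : x ∈ Ω)
    (h : qhDist Ω x y < ENNReal.ofReal ((N + 1) * η)) :
    ∃ a : ℕ → EuclideanSpace ℝ (Fin n), a 0 = x ∧ a (N + 1) = y ∧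
      ∀ i ≤ N, qhDist Ω (a i) (a (i + 1)) < ENNReal.ofReal η := by
  induction N generalizing x with
  | zero =>
    refine ⟨fun i => if i = 0 then x else y, by simp, by simp, fun i hi => ?_⟩
    obtain rfl : i = 0 := by omega
    simpa using h
  | succ N ih =>
    obtain ⟨p, hp, h1, h2⟩ := exists_qhDist_lt_of_lt_add (s := η) (t := (N + 1) * η) ho hne hη
      (by positivity) (by convert h using 2; push_cast; ring)
    obtain ⟨a, ha0, haN, ha⟩ := ih hp h2
    refine ⟨fun i => Nat.casesOn i x a, rfl, haN, fun i hi => ?_⟩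
    cases i with
    | zero => simpa [ha0] using h1
    | succ i => exact ha i (by omega)

end Distance

/-! ### Convex combinations of chains in an inner product space -/

section InnerProduct

variable {E : Type*} [NormedAddCommGroup E] [InnerProductSpace ℝ E]

lemma sq_norm_convexComb (a b : E) (l : ℝ) :
    ‖(1 - l) • a + l • b‖ ^ 2 =
      (1 - l) * ‖a‖ ^ 2 + l * ‖b‖ ^ 2 - l * (1 - l) * ‖a - b‖ ^ 2 := by
  rw [norm_add_sq_real, norm_sub_sq_real, norm_smul, norm_smul, mul_pow, mul_pow,
    Real.norm_eq_abs, Real.norm_eq_abs, sq_abs, sq_abs, real_inner_smul_left,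
    real_inner_smul_right]
  ring

lemma norm_convexComb_le (a b : E) {l : ℝ} (h0 : 0 ≤ l) (h1 : l ≤ 1) {r : ℝ} (ha : ‖a‖ ≤ r)
    (hb : ‖b‖ ≤ r) : ‖(1 - l) • a + l • b‖ ≤ r := by
  have := convex_closedBall (0 : E) r (mem_closedBall_zero_iff.2 ha) (mem_closedBall_zero_iff.2 hb)
    (sub_nonneg.2 h1) h0 (by ring)
  exact mem_closedBall_zero_iff.1 this

/-- The squared distance to a closed set is semiconcave. -/
lemma sq_infDist_convexComb_ge [ProperSpace E] {F : Set E} (hF : IsClosed F) (hne : F.Nonempty)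
    (a b : E) {l : ℝ} (h0 : 0 ≤ l) (h1 : l ≤ 1) :
    (1 - l) * Metric.infDist a F ^ 2 + l * Metric.infDist b F ^ 2 ≤
      Metric.infDist ((1 - l) • a + l • b) F ^ 2 + l * (1 - l) * ‖a - b‖ ^ 2 := by
  -- A nearest point `p` for the combination is only a competitor for `a` and `b`, and for the
  -- squared distance to a fixed `p` the relation is an identity.
  obtain ⟨p, hp, hd⟩ := hF.exists_infDist_eq_dist hne ((1 - l) • a + l • b)
  have e : (1 - l) • a + l • b - p = (1 - l) • (a - p) + l • (b - p) := by module
  have ha := Metric.infDist_le_dist_of_mem (x := a) hp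
  have hb := Metric.infDist_le_dist_of_mem (x := b) hp
  rw [hd, dist_eq_norm, e, sq_norm_convexComb, sub_sub_sub_cancel_right]
  rw [dist_eq_norm] at ha hb
  have h1' : 0 ≤ 1 - l := by linarith
  have := Metric.infDist_nonneg (x := a) (s := F)
  have := Metric.infDist_nonneg (x := b) (s := F)
  have : (1 - l) * Metric.infDist a F ^ 2 ≤ (1 - l) * ‖a - p‖ ^ 2 := by gcongr
  have : l * Metric.infDist b F ^ 2 ≤ l * ‖b - p‖ ^ 2 := by gcongr
  linarith

/-- The discrete Poincaré inequality for a sequence that starts at `0`. -/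
lemma sq_norm_le_mul_sum_sq {E : Type*} [NormedAddCommGroup E] (h : ℕ → E) (h0 : h 0 = 0) {k M : ℕ} (hk : k ≤ M) :
    ‖h k‖ ^ 2 ≤ M * ∑ i ∈ Finset.range M, ‖h (i + 1) - h i‖ ^ 2 := by
  have e : h k = ∑ i ∈ Finset.range k, (h (i + 1) - h i) := by
    rw [Finset.sum_range_sub, h0, sub_zero]
  calc ‖h k‖ ^ 2 ≤ (∑ i ∈ Finset.range k, ‖h (i + 1) - h i‖) ^ 2 := by
        conv_lhs => rw [e]
        gcongr
        exact norm_sum_le _ _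
    _ ≤ k * ∑ i ∈ Finset.range k, ‖h (i + 1) - h i‖ ^ 2 := by
        simpa using sq_sum_le_card_mul_sum_sq (s := Finset.range k)
          (f := fun i => ‖h (i + 1) - h i‖)
    _ ≤ M * ∑ i ∈ Finset.range M, ‖h (i + 1) - h i‖ ^ 2 := by
        gcongr

/-- Comparison of the discrete quasihyperbolic length of a convex combination of two chains with
that of the chains. -/
lemma sq_sum_div_infDist_le [ProperSpace E] {F : Set E} (hF : IsClosed F) (hne : F.Nonempty)
    {a b : ℕ → E} (hab : a 0 = b 0) {M : ℕ} {κ d l : ℝ} (hd : 0 < d) (h0 : 0 ≤ l)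
    (h1 : l ≤ 1) (hκ : (M * κ) ^ 2 ≤ 1 / 8)
    (ha : ∀ i < M, ‖a (i + 1) - a i‖ ≤ κ * Metric.infDist (a i) F)
    (hb : ∀ i < M, ‖b (i + 1) - b i‖ ≤ κ * Metric.infDist (b i) F)
    (hu : ∀ i < M, Metric.infDist ((1 - l) • a i + l • b i) F ^ 2 ≤ 2 * d ^ 2)
    (hl : ∀ i < M, d ^ 2 ≤ 2 * Metric.infDist ((1 - l) • a i + l • b i) F ^ 2) :
    (∑ i ∈ Finset.range M, ‖((1 - l) • a (i + 1) + l • b (i + 1)) - ((1 - l) • a i + l • b i)‖ /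
      Metric.infDist ((1 - l) • a i + l • b i) F) ^ 2 ≤
        (M * κ) ^ 2 - l * (1 - l) * ‖a M - b M‖ ^ 2 / (4 * d ^ 2) := by
  set m : ℕ → E := fun i => (1 - l) • a i + l • b i with hm
  set h : ℕ → E := fun i => a i - b i with hh
  set S := ∑ i ∈ Finset.range M, ‖h (i + 1) - h i‖ ^ 2 with hS
  have hS0 : 0 ≤ S := by positivity
  have hl0 : 0 ≤ l * (1 - l) := mul_nonneg h0 (by linarith)
  have hpoin : ∀ k ≤ M, ‖h k‖ ^ 2 ≤ M * S := fun k hk =>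
    sq_norm_le_mul_sum_sq h (by simp [hh, hab]) hk
  have hstep : ∀ i ∈ Finset.range M, (‖m (i + 1) - m i‖ / Metric.infDist (m i) F) ^ 2 ≤
      κ ^ 2 + l * (1 - l) * (2 * κ ^ 2 * (M * S) - ‖h (i + 1) - h i‖ ^ 2 / 2) / d ^ 2 := by
    intro i hi
    have hi := Finset.mem_range.1 hi
    set D := Metric.infDist (m i) F with hD
    have hD1 : D ^ 2 ≤ 2 * d ^ 2 := hu i hi
    have hD2 : d ^ 2 ≤ 2 * D ^ 2 := hl i hi
    have hd2 : 0 < d ^ 2 := by positivity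
    have hDpos : 0 < D ^ 2 := by linarith
    have e : m (i + 1) - m i = (1 - l) • (a (i + 1) - a i) + l • (b (i + 1) - b i) := by
      simp only [hm]; module
    have e' : (a (i + 1) - a i) - (b (i + 1) - b i) = h (i + 1) - h i := by
      simp only [hh]; abel
    -- The term with `‖h i‖²` is the cost of semiconcavity, the one with the increment of `h` the
    -- gain from the norm identity.
    have key : ‖m (i + 1) - m i‖ ^ 2 ≤
        κ ^ 2 * D ^ 2 + l * (1 - l) * (κ ^ 2 * ‖h i‖ ^ 2 - ‖h (i + 1) - h i‖ ^ 2) := by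
      rw [e, sq_norm_convexComb, e']
      have q1 : ‖a (i + 1) - a i‖ ^ 2 ≤ (κ * Metric.infDist (a i) F) ^ 2 := by
        gcongr; exact ha i hi
      have q2 : ‖b (i + 1) - b i‖ ^ 2 ≤ (κ * Metric.infDist (b i) F) ^ 2 := by
        gcongr; exact hb i hi
      have q3 := mul_le_mul_of_nonneg_left q1 (sub_nonneg.2 h1)
      have q4 := mul_le_mul_of_nonneg_left q2 h0
      have q5 := mul_le_mul_of_nonneg_left
        (sq_infDist_convexComb_ge hF hne (a i) (b i) h0 h1) (sq_nonneg κ)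
      change _ ≤ κ ^ 2 * (D ^ 2 + l * (1 - l) * ‖h i‖ ^ 2) at q5
      nlinarith
    rw [div_pow, div_le_iff₀ hDpos]
    refine key.trans ?_
    -- The varying `D` is exchanged for the fixed `d`, which costs a factor `2` in each of `r1` and
    -- `r2`.
    have r1 : κ ^ 2 * ‖h i‖ ^ 2 ≤ 2 * κ ^ 2 * (M * S) / d ^ 2 * D ^ 2 := by
      rw [div_mul_eq_mul_div, le_div_iff₀ hd2]
      have := hpoin i hi.le
      calc κ ^ 2 * ‖h i‖ ^ 2 * d ^ 2 ≤ κ ^ 2 * (M * S) * (2 * D ^ 2) := by gcongr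
        _ = _ := by ring
    have r2 : ‖h (i + 1) - h i‖ ^ 2 / 2 / d ^ 2 * D ^ 2 ≤ ‖h (i + 1) - h i‖ ^ 2 := by
      rw [div_mul_eq_mul_div, div_le_iff₀ hd2]
      calc ‖h (i + 1) - h i‖ ^ 2 / 2 * D ^ 2 ≤ ‖h (i + 1) - h i‖ ^ 2 / 2 * (2 * d ^ 2) := by
            gcongr
        _ = _ := by ring
    have r3 := mul_le_mul_of_nonneg_left (sub_le_sub r1 r2) hl0
    calc _ ≤ κ ^ 2 * D ^ 2 + l * (1 - l) * (2 * κ ^ 2 * (M * S) / d ^ 2 * D ^ 2 -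
          ‖h (i + 1) - h i‖ ^ 2 / 2 / d ^ 2 * D ^ 2) := by linarith
      _ = _ := by ring
  have hsum := Finset.sum_le_sum hstep
  rw [Finset.sum_add_distrib, ← Finset.sum_div, ← Finset.mul_sum, Finset.sum_sub_distrib,
    ← Finset.sum_div, ← hS] at hsum
  simp only [Finset.sum_const, Finset.card_range, nsmul_eq_mul] at hsum
  have hCS := sq_sum_le_card_mul_sum_sq (s := Finset.range M)
    (f := fun i => ‖m (i + 1) - m i‖ / Metric.infDist (m i) F)
  rw [Finset.card_range] at hCS
  refine hCS.trans ((mul_le_mul_of_nonneg_left hsum (Nat.cast_nonneg M)).trans ?_)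
  have hlast : ‖a M - b M‖ ^ 2 ≤ M * S := hpoin M le_rfl
  -- The cost is `2 (Mκ)² M S ≤ M S / 4`, half of the gain `M S / 2`: this is where `1 / 8` comes
  -- from.
  have hfin : (M : ℝ) * (M * (2 * κ ^ 2 * (M * S)) - S / 2) ≤ -(M * S / 4) := by
    have : (M : ℝ) * S * (M * κ) ^ 2 ≤ M * S * (1 / 8) := by gcongr
    linarith
  have hfin2 : (M : ℝ) * (M * (2 * κ ^ 2 * (M * S)) - S / 2) ≤ -(‖a M - b M‖ ^ 2 / 4) := by
    linarith
  calc (M : ℝ) * (M * κ ^ 2 + l * (1 - l) * (M * (2 * κ ^ 2 * (M * S)) - S / 2) / d ^ 2)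
      = (M * κ) ^ 2 + l * (1 - l) / d ^ 2 *
          (M * (M * (2 * κ ^ 2 * (M * S)) - S / 2)) := by ring
    _ ≤ (M * κ) ^ 2 + l * (1 - l) / d ^ 2 * (-(‖a M - b M‖ ^ 2 / 4)) := by gcongr
    _ = _ := by field_simp; ring

end InnerProduct

/-! ### Quantitative strict convexity -/

section Convexity

variable {n : ℕ} {Ω : Set (EuclideanSpace ℝ (Fin n))} {x y z : EuclideanSpace ℝ (Fin n)}

lemma exp_sub_one_le {t : ℝ} (h0 : 0 ≤ t) (h1 : t ≤ 1) : Real.exp t - 1 ≤ t * (1 + t) := by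
  have := (abs_le.1 (Real.abs_exp_sub_one_sub_id_le (by rwa [abs_of_nonneg h0]))).2
  linarith

lemma exp_sub_one_le_of_le {t : ℝ} (h0 : 0 ≤ t) (h1 : t ≤ 1 / 40) : Real.exp t - 1 ≤ 1 / 30 :=
  (exp_sub_one_le h0 (by linarith)).trans (by nlinarith)

lemma qhDist_le_ofReal_sum (ho : IsOpen Ω) (hne : (frontier Ω).Nonempty)
    {m : ℕ → EuclideanSpace ℝ (Fin n)} {u : ℕ → ℝ} {M : ℕ} (h0 : m 0 ∈ Ω)
    (hu : ∀ i < M, 0 ≤ u i) (h : ∀ i < M, qhDist Ω (m i) (m (i + 1)) ≤ ENNReal.ofReal (u i)) :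
    qhDist Ω (m 0) (m M) ≤ ENNReal.ofReal (∑ i ∈ Finset.range M, u i) := by
  induction M with
  | zero => simp [qhDist_self ho hne h0]
  | succ M ih =>
    rw [Finset.sum_range_succ, ENNReal.ofReal_add
      (Finset.sum_nonneg fun i hi => hu i (by have := Finset.mem_range.1 hi; omega))
      (hu M (by omega))]
    exact (qhDist_triangle _ (m M) _).trans (add_le_add
      (ih (fun i hi => hu i (by omega)) fun i hi => h i (by omega)) (h M (by omega)))

lemma dist_le_of_chain (ho : IsOpen Ω) (hne : (frontier Ω).Nonempty)
    {a : ℕ → EuclideanSpace ℝ (Fin n)} {η : ℝ} (hη : 0 ≤ η) {M : ℕ} (hM : M * η ≤ 1 / 40) (h0 : a 0 ∈ Ω)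
    (h : ∀ i < M, qhDist Ω (a i) (a (i + 1)) ≤ ENNReal.ofReal η) {k : ℕ} (hk : k ≤ M) :
    dist (a 0) (a k) ≤ Metric.infDist (a 0) (frontier Ω) * (1 / 30) := by
  have h1 := qhDist_le_ofReal_sum ho hne (u := fun _ => η) (M := k) h0 (fun _ _ => hη)
    fun i hi => h i (by omega)
  rw [Finset.sum_const, Finset.card_range, nsmul_eq_mul] at h1
  have hk' : (k : ℝ) * η ≤ M * η := by gcongr
  refine (dist_le_of_qhDist_le ho hne h0 (by positivity) h1).trans ?_
  exact mul_le_mul_of_nonneg_left (exp_sub_one_le_of_le (by positivity) (hk'.trans hM))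
    Metric.infDist_nonneg

/-- The estimate at a fixed mesh `η`. Passing between distances and Euclidean step lengths produces
the two errors: `1 + η` from `e^η - 1` for the given chains, and the denominator from the segments
joining consecutive points of the combined chain. -/
lemma qhDist_convexComb_le_of_chain (ho : IsOpen Ω) (hne : (frontier Ω).Nonempty) (hx : x ∈ Ω)
    {ρ l : ℝ} (hρ0 : 0 < ρ) (hρ : ρ ≤ 1 / 40) (hl0 : 0 ≤ l) (hl1 : l ≤ 1)
    (hy : qhDist Ω x y < ENNReal.ofReal ρ) (hz : qhDist Ω x z < ENNReal.ofReal ρ) (N : ℕ)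
    {η : ℝ} (hη : η = ρ / (N + 1)) :
    qhDist Ω x ((1 - l) • y + l • z) ≤ ENNReal.ofReal
      (√((ρ * (1 + η)) ^ 2 - l * (1 - l) * ‖y - z‖ ^ 2 /
        (4 * Metric.infDist x (frontier Ω) ^ 2)) / (1 - 2 * (η * (1 + η)))) := by
  have hN : (0 : ℝ) < N + 1 := by positivity
  have hη0 : 0 < η := by rw [hη]; positivity
  have hMη : (N + 1) * η = ρ := by rw [hη]; field_simp
  have hη1 : η ≤ 1 / 40 := by
    have : (0 : ℝ) ≤ N * η := by positivity
    linarith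
  obtain ⟨a, ha0, haN, ha⟩ := exists_chain ho hne hη0 N (y := y) hx (by rwa [hMη])
  obtain ⟨b, hb0, hbN, hb⟩ := exists_chain ho hne hη0 N (y := z) hx (by rwa [hMη])
  set d := Metric.infDist x (frontier Ω) with hd
  have hd0 : 0 < d := infDist_frontier_pos ho hne hx
  have hmem : ∀ {a : ℕ → EuclideanSpace ℝ (Fin n)},
      (∀ i ≤ N, qhDist Ω (a i) (a (i + 1)) < ENNReal.ofReal η) → ∀ i ≤ N, a i ∈ Ω :=
    fun h i hi => (qhDist_lt_top_mem ((h i hi).trans ENNReal.ofReal_lt_top)).1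
  -- Everything stays in the Euclidean ball of radius `d / 30` about `x`, which is convex and on
  -- which the boundary distance lies between `29/30 d` and `31/30 d`.
  have hnear : ∀ {a : ℕ → EuclideanSpace ℝ (Fin n)}, a 0 = x →
      (∀ i ≤ N, qhDist Ω (a i) (a (i + 1)) < ENNReal.ofReal η) →
      ∀ i ≤ N + 1, ‖a i - x‖ ≤ d * (1 / 30) := by
    intro a h0 h i hi
    have := dist_le_of_chain ho hne hη0.le (M := N + 1) (by push_cast; linarith)
      (by rwa [h0]) (fun i hi => (h i (by omega)).le) hi
    rwa [h0, dist_comm, dist_eq_norm] at this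
  set κ := η * (1 + η) with hκ
  have hκ0 : 0 < κ := by positivity
  have hκ1 : κ ≤ 1 / 30 := by nlinarith
  have hstep : ∀ {a : ℕ → EuclideanSpace ℝ (Fin n)},
      (∀ i ≤ N, qhDist Ω (a i) (a (i + 1)) < ENNReal.ofReal η) →
      ∀ i < N + 1, ‖a (i + 1) - a i‖ ≤ κ * Metric.infDist (a i) (frontier Ω) := by
    intro a h i hi
    have h1 := dist_le_of_qhDist_le ho hne (hmem h i (by omega)) hη0.le (h i (by omega)).le
    rw [dist_comm, dist_eq_norm, mul_comm] at h1
    exact h1.trans (mul_le_mul_of_nonneg_right (exp_sub_one_le hη0.le (by linarith))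
      Metric.infDist_nonneg)
  set m : ℕ → EuclideanSpace ℝ (Fin n) := fun i => (1 - l) • a i + l • b i with hm
  have hmx : ∀ i ≤ N + 1, dist x (m i) ≤ d * (1 / 30) := by
    intro i hi
    have e : m i - x = (1 - l) • (a i - x) + l • (b i - x) := by simp only [hm]; module
    rw [dist_comm, dist_eq_norm, e]
    exact norm_convexComb_le _ _ hl0 hl1 (hnear ha0 ha i hi) (hnear hb0 hb i hi)
  have hlow : ∀ i ≤ N + 1, d * (29 / 30) ≤ Metric.infDist (m i) (frontier Ω) := fun i hi => by
    have := infDist_frontier_le_add (Ω := Ω) (m i) x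
    rw [dist_comm] at this
    linarith [hmx i hi]
  have hupp : ∀ {p}, dist x p ≤ d * (1 / 30) → Metric.infDist p (frontier Ω) ≤ d * (31 / 30) :=
    fun {p} hp => by
      have := infDist_frontier_le_add (Ω := Ω) x p
      linarith
  have hmΩ : ∀ i ≤ N + 1, m i ∈ Ω := fun i hi => ball_infDist_frontier_subset ho hx <| by
    rw [Metric.mem_ball, dist_comm]
    linarith [hmx i hi]
  have hm0 : m 0 = x := by simp only [hm, ha0, hb0]; module
  set u : ℕ → ℝ := fun i => ‖m (i + 1) - m i‖ / Metric.infDist (m i) (frontier Ω) with hu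
  have hu0 : ∀ i, 0 ≤ u i := fun i => div_nonneg (norm_nonneg _) Metric.infDist_nonneg
  have hmstep : ∀ i < N + 1,
      qhDist Ω (m i) (m (i + 1)) ≤ ENNReal.ofReal (u i / (1 - 2 * κ)) := by
    intro i hi
    set D := Metric.infDist (m i) (frontier Ω) with hD
    have hD0 : d * (29 / 30) ≤ D := hlow i hi.le
    have e : m (i + 1) - m i = (1 - l) • (a (i + 1) - a i) + l • (b (i + 1) - b i) := by
      simp only [hm]; module
    have hs : ∀ {a : ℕ → EuclideanSpace ℝ (Fin n)}, a 0 = x →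
        (∀ i ≤ N, qhDist Ω (a i) (a (i + 1)) < ENNReal.ofReal η) →
        ‖a (i + 1) - a i‖ ≤ κ * (d * (31 / 30)) := fun {a} h0 h =>
      (hstep h i hi).trans (mul_le_mul_of_nonneg_left
        (hupp (by rw [dist_comm, dist_eq_norm]; exact hnear h0 h i hi.le)) hκ0.le)
    have hle : ‖m (i + 1) - m i‖ ≤ κ * (d * (31 / 30)) := by
      rw [e]
      exact norm_convexComb_le _ _ hl0 hl1 (hs ha0 ha) (hs hb0 hb)
    -- The factor `2` generously covers the ratio `31/29` of the boundary distances.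
    have hle2 : ‖m (i + 1) - m i‖ ≤ 2 * κ * D := by nlinarith
    have hDpos : 0 < D := by linarith
    have hdist : dist (m i) (m (i + 1)) = ‖m (i + 1) - m i‖ := by rw [dist_comm, dist_eq_norm]
    have hq := qhDist_le_of_dist_lt (q := m (i + 1)) ho (hmΩ i hi.le)
      (by rw [hdist, ← hD]; nlinarith)
    refine hq.trans (ENNReal.ofReal_le_ofReal ?_)
    rw [hdist, ← hD, hu]
    simp only
    rw [← hD, div_div]
    have hpos : 0 < D * (1 - 2 * κ) := mul_pos hDpos (by linarith)
    gcongr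
    linarith
  have hmain := sq_sum_div_infDist_le (M := N + 1) (κ := κ) (d := d) isClosed_frontier hne
    (ha0.trans hb0.symm) hd0 hl0 hl1
    (by
      have : ((N + 1 : ℕ) : ℝ) * κ = ρ * (1 + η) := by
        rw [hκ, ← hMη]; push_cast; ring
      rw [this]
      have : ρ * (1 + η) ≤ 1 / 20 := by nlinarith
      have : 0 ≤ ρ * (1 + η) := by positivity
      nlinarith)
    (hstep ha) (hstep hb)
    (fun i hi => by
      have h1 : Metric.infDist (m i) (frontier Ω) ≤ d * (31 / 30) := hupp (hmx i hi.le)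
      have h2 : 0 ≤ Metric.infDist (m i) (frontier Ω) := Metric.infDist_nonneg
      change Metric.infDist (m i) (frontier Ω) ^ 2 ≤ _
      nlinarith)
    (fun i hi => by
      have h1 := hlow i hi.le
      change _ ≤ 2 * Metric.infDist (m i) (frontier Ω) ^ 2
      nlinarith)
  have hMκ : ((N + 1 : ℕ) : ℝ) * κ = ρ * (1 + η) := by
    rw [hκ, ← hMη]; push_cast; ring
  rw [hMκ, haN, hbN] at hmain
  have hfin := qhDist_le_ofReal_sum ho hne (hmΩ 0 (by omega))
    (fun i _ => div_nonneg (hu0 i) (by linarith)) hmstep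
  have hmN : m (N + 1) = (1 - l) • y + l • z := by simp only [hm, haN, hbN]
  rw [hm0, hmN, ← Finset.sum_div] at hfin
  refine hfin.trans (ENNReal.ofReal_le_ofReal ?_)
  have : 0 < 1 - 2 * κ := by linarith
  gcongr
  exact Real.le_sqrt_of_sq_le hmain

/-- Quantitative strict convexity of small quasihyperbolic balls. -/
lemma qhDist_convexComb_le (ho : IsOpen Ω) (hne : (frontier Ω).Nonempty) (hx : x ∈ Ω)
    {ρ l : ℝ} (hρ0 : 0 < ρ) (hρ : ρ ≤ 1 / 40) (hl0 : 0 ≤ l) (hl1 : l ≤ 1)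
    (hy : qhDist Ω x y < ENNReal.ofReal ρ) (hz : qhDist Ω x z < ENNReal.ofReal ρ) :
    qhDist Ω x ((1 - l) • y + l • z) ≤ ENNReal.ofReal
      √(ρ ^ 2 - l * (1 - l) * ‖y - z‖ ^ 2 / (4 * Metric.infDist x (frontier Ω) ^ 2)) := by
  set T := l * (1 - l) * ‖y - z‖ ^ 2 / (4 * Metric.infDist x (frontier Ω) ^ 2) with hT
  -- As the mesh tends to `0`, both discretization errors disappear.
  have hlim : Filter.Tendsto (fun N : ℕ => ρ / ((N : ℝ) + 1)) Filter.atTop (nhds 0) := by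
    simpa [div_eq_mul_inv] using tendsto_one_div_add_atTop_nhds_zero_nat.const_mul ρ
  have hcont : ContinuousAt (fun η : ℝ => ENNReal.ofReal
      (√((ρ * (1 + η)) ^ 2 - T) / (1 - 2 * (η * (1 + η))))) 0 := by
    refine ENNReal.continuous_ofReal.continuousAt.comp (ContinuousAt.div ?_ ?_ (by simp)) <;>
      fun_prop
  have := hcont.tendsto.comp hlim
  simp only [add_zero, mul_one, mul_zero, sub_zero, div_one] at this
  exact ge_of_tendsto' this fun N =>
    qhDist_convexComb_le_of_chain ho hne hx hρ0 hρ hl0 hl1 hy hz N rfl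

lemma qhDist_convexComb_lt (ho : IsOpen Ω) (hne : (frontier Ω).Nonempty) (hx : x ∈ Ω)
    {r l : ℝ} (hr0 : 0 < r) (hr : r ≤ 1 / 50) (hl0 : 0 < l) (hl1 : l < 1) (hyz : y ≠ z)
    (hy : qhDist Ω x y ≤ ENNReal.ofReal r) (hz : qhDist Ω x z ≤ ENNReal.ofReal r) :
    qhDist Ω x ((1 - l) • y + l • z) < ENNReal.ofReal r := by
  have hd := infDist_frontier_pos ho hne hx
  set T := l * (1 - l) * ‖y - z‖ ^ 2 / (4 * Metric.infDist x (frontier Ω) ^ 2) with hT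
  have hT0 : 0 < T := by
    have := norm_pos_iff.2 (sub_ne_zero.2 hyz)
    have : 0 < 1 - l := by linarith
    positivity
  -- The estimate needs strict inequalities, so the radius is enlarged slightly; since `ρ + r < 1`,
  -- the increase `ρ² - r²` stays below the gain `T`.
  set ρ := min (1 / 40) (r + T / 2) with hρ
  have h1 : r < ρ := lt_min (by linarith) (by linarith)
  have h2 : ρ ≤ 1 / 40 := min_le_left _ _
  have h3 : ρ ≤ r + T / 2 := min_le_right _ _
  have h4 : ENNReal.ofReal r < ENNReal.ofReal ρ :=
    (ENNReal.ofReal_lt_ofReal_iff (by linarith)).2 h1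
  refine (qhDist_convexComb_le ho hne hx (by linarith) h2 hl0.le hl1.le (hy.trans_lt h4)
    (hz.trans_lt h4)).trans_lt ((ENNReal.ofReal_lt_ofReal_iff hr0).2 ?_)
  rw [Real.sqrt_lt' hr0]
  nlinarith

end Convexity

/-! ### Topology of quasihyperbolic balls -/

section Topology

variable {n : ℕ} {Ω : Set (EuclideanSpace ℝ (Fin n))} {x y p q : EuclideanSpace ℝ (Fin n)}

lemma tendsto_qhDist_self (ho : IsOpen Ω) (hne : (frontier Ω).Nonempty) (hp : p ∈ Ω) :
    Filter.Tendsto (fun q => qhDist Ω p q) (nhds p) (nhds 0) := by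
  have hd := infDist_frontier_pos ho hne hp
  have hdist : Filter.Tendsto (fun q => dist p q) (nhds p) (nhds 0) := by
    simpa using (tendsto_const_nhds (x := p)).dist (Filter.tendsto_id (x := nhds p))
  have hlim : Filter.Tendsto (fun q => ENNReal.ofReal
      (dist p q / (Metric.infDist p (frontier Ω) - dist p q))) (nhds p) (nhds 0) := by
    have := ENNReal.tendsto_ofReal
      (hdist.div (tendsto_const_nhds.sub hdist) (by simpa using hd.ne'))
    simpa using this
  refine tendsto_of_tendsto_of_tendsto_of_le_of_le' tendsto_const_nhds hlim
    (.of_forall fun _ => zero_le) ?_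
  filter_upwards [hdist.eventually_lt_const hd] with q hq
  exact qhDist_le_of_dist_lt ho hp hq

lemma isOpen_setOf_qhDist_lt (ho : IsOpen Ω) (hne : (frontier Ω).Nonempty)
    (x : EuclideanSpace ℝ (Fin n)) (c : ℝ≥0∞) : IsOpen {p | p ∈ Ω ∧ qhDist Ω x p < c} := by
  refine isOpen_iff_mem_nhds.2 fun p hp => ?_
  have hlim := (tendsto_qhDist_self ho hne hp.1).const_add (qhDist Ω x p)
  rw [add_zero] at hlim
  filter_upwards [ho.mem_nhds hp.1, hlim.eventually_lt_const hp.2] with q hq hlt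
  exact ⟨hq, (qhDist_triangle x p q).trans_lt hlt⟩

lemma qhDist_le_of_tendsto (ho : IsOpen Ω) (hne : (frontier Ω).Nonempty) (hp : p ∈ Ω)
    {ι : Type*} {F : Filter ι} [F.NeBot] {u : ι → EuclideanSpace ℝ (Fin n)} {c : ι → ℝ≥0∞}
    {c₀ : ℝ≥0∞} (hu : Filter.Tendsto u F (nhds p)) (hc : Filter.Tendsto c F (nhds c₀))
    (h : ∀ᶠ i in F, qhDist Ω x (u i) ≤ c i) : qhDist Ω x p ≤ c₀ := by
  have hlim := hc.add ((tendsto_qhDist_self ho hne hp).comp hu)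
  rw [add_zero] at hlim
  refine ge_of_tendsto hlim (h.mono fun i hi => ?_)
  refine (qhDist_triangle x (u i) p).trans (add_le_add hi ?_)
  rw [qhDist_comm]
  rfl

lemma dist_le_of_qhDist_le_ofReal (ho : IsOpen Ω) (hne : (frontier Ω).Nonempty) (hx : x ∈ Ω)
    {r : ℝ} (h0 : 0 ≤ r) (hr : r ≤ 1 / 40) (h : qhDist Ω x p ≤ ENNReal.ofReal r) :
    dist x p ≤ Metric.infDist x (frontier Ω) * (1 / 30) :=
  (dist_le_of_qhDist_le ho hne hx h0 h).trans
    (mul_le_mul_of_nonneg_left (exp_sub_one_le_of_le h0 hr) Metric.infDist_nonneg)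

lemma closedBall_subset (ho : IsOpen Ω) (hne : (frontier Ω).Nonempty) (hx : x ∈ Ω) :
    Metric.closedBall x (Metric.infDist x (frontier Ω) * (1 / 30)) ⊆ Ω :=
  (Metric.closedBall_subset_ball (by linarith [infDist_frontier_pos ho hne hx])).trans
    (ball_infDist_frontier_subset ho hx)

/-- Limits cannot escape to the boundary, because the ball lies in a closed Euclidean ball inside
`Ω`; there the distance passes to the limit. -/
lemma closure_qhClosedBall_subset (ho : IsOpen Ω) (hne : (frontier Ω).Nonempty) (hx : x ∈ Ω)
    {r : ℝ} (h0 : 0 ≤ r) (hr : r ≤ 1 / 40) :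
    closure (qhClosedBall Ω x r) ⊆ qhClosedBall Ω x r := by
  intro p hp
  have hpΩ : p ∈ Ω := by
    refine closedBall_subset ho hne hx (closure_minimal (fun q hq => ?_)
      Metric.isClosed_closedBall hp)
    rw [Metric.mem_closedBall, dist_comm]
    exact dist_le_of_qhDist_le_ofReal ho hne hx h0 hr hq.2
  have : (nhdsWithin p (qhClosedBall Ω x r)).NeBot := mem_closure_iff_nhdsWithin_neBot.1 hp
  exact ⟨hpΩ, qhDist_le_of_tendsto (F := nhdsWithin p (qhClosedBall Ω x r)) ho hne hpΩ
    (u := id) nhdsWithin_le_nhds tendsto_const_nhds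
    (by filter_upwards [self_mem_nhdsWithin] with q hq using hq.2)⟩

lemma openSegment_subset_qhBall (ho : IsOpen Ω) (hne : (frontier Ω).Nonempty) (hx : x ∈ Ω)
    {r : ℝ} (h0 : 0 < r) (hr : r ≤ 1 / 50) {y z : EuclideanSpace ℝ (Fin n)}
    (hy : y ∈ qhClosedBall Ω x r) (hz : z ∈ qhClosedBall Ω x r) (hyz : y ≠ z) :
    openSegment ℝ y z ⊆ qhBall Ω x r := by
  rintro _ ⟨k, l, hk, hl, hkl, rfl⟩
  obtain rfl : k = 1 - l := by linarith
  have hlt := qhDist_convexComb_lt ho hne hx h0 hr hl (by linarith) hyz hy.2 hz.2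
  exact ⟨(qhDist_lt_top_mem (hlt.trans ENNReal.ofReal_lt_top)).2, hlt⟩

lemma qhBall_subset_qhClosedBall (r : ℝ) : qhBall Ω x r ⊆ qhClosedBall Ω x r :=
  fun _ hp => ⟨hp.1, hp.2.le⟩

lemma isOpen_qhBall (ho : IsOpen Ω) (hne : (frontier Ω).Nonempty) (r : ℝ) :
    IsOpen (qhBall Ω x r) :=
  isOpen_setOf_qhDist_lt ho hne x _

/-- A set between an open quasihyperbolic ball of small radius and the closed one is strictly
convex. -/
lemma isStrictlyConvex_of_subset (ho : IsOpen Ω) (hne : (frontier Ω).Nonempty) (hx : x ∈ Ω)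
    {r : ℝ} (h0 : 0 < r) (hr : r ≤ 1 / 50) {G : Set (EuclideanSpace ℝ (Fin n))}
    (h1 : qhBall Ω x r ⊆ G) (h2 : G ⊆ qhClosedBall Ω x r) : IsStrictlyConvex G := by
  have hcl : closure G ⊆ qhClosedBall Ω x r :=
    (closure_mono h2).trans (closure_qhClosedBall_subset ho hne hx h0.le (by linarith))
  exact fun y hy z hz hyz => (openSegment_subset_qhBall ho hne hx h0 hr (hcl hy) (hcl hz) hyz).trans
    (interior_maximal h1 (isOpen_qhBall ho hne r))

end Topology

/-! ### Existence and uniqueness of geodesics -/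

section Geodesics

variable {n : ℕ} {Ω : Set (EuclideanSpace ℝ (Fin n))} {x y p q : EuclideanSpace ℝ (Fin n)}

/-- Cut almost shortest curves and take a limit of the cutting points, which lie in a compact subset
of `Ω`. -/
lemma exists_between (ho : IsOpen Ω) (hne : (frontier Ω).Nonempty) (hx : x ∈ Ω) {s t : ℝ}
    (hs : 0 ≤ s) (ht : 0 ≤ t) (hst : s + t ≤ 1 / 50)
    (h : qhDist Ω x y ≤ ENNReal.ofReal (s + t)) :
    ∃ p ∈ Ω, qhDist Ω x p ≤ ENNReal.ofReal s ∧ qhDist Ω p y ≤ ENNReal.ofReal t := by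
  have hε : Filter.Tendsto (fun k : ℕ => (1 / 200 : ℝ) * (1 / ((k : ℝ) + 1))) Filter.atTop
      (nhds 0) := by
    simpa using (tendsto_one_div_add_atTop_nhds_zero_nat (𝕜 := ℝ)).const_mul (1 / 200 : ℝ)
  -- The factor `1/200` keeps `s + ε k` within `1/50 + 1/200 = 1/40`.
  set ε : ℕ → ℝ := fun k => (1 / 200 : ℝ) * (1 / ((k : ℝ) + 1)) with hεdef
  have hε0 : ∀ k, 0 < ε k := fun k => by positivity
  have hε1 : ∀ k, ε k ≤ 1 / 200 := fun k => by
    have : 1 / ((k : ℝ) + 1) ≤ 1 := by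
      rw [div_le_one (by positivity)]
      linarith [(Nat.cast_nonneg k : (0 : ℝ) ≤ k)]
    simp only [hεdef]
    linarith
  have hex : ∀ k, ∃ p ∈ Ω, qhDist Ω x p < ENNReal.ofReal (s + ε k) ∧
      qhDist Ω p y < ENNReal.ofReal (t + ε k) := fun k =>
    exists_qhDist_lt_of_lt_add ho hne (by linarith [hε0 k]) (by linarith [hε0 k])
      (h.trans_lt ((ENNReal.ofReal_lt_ofReal_iff (by linarith [hε0 k])).2 (by linarith [hε0 k])))
  choose u huΩ hux huy using hex
  obtain ⟨p, hp, φ, hφ, hlim⟩ := (isCompact_closedBall x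
    (Metric.infDist x (frontier Ω) * (1 / 30))).tendsto_subseq (x := u) fun k => by
      rw [Metric.mem_closedBall, dist_comm]
      exact dist_le_of_qhDist_le_ofReal ho hne hx (by linarith [hε0 k])
        (by linarith [hε1 k]) (hux k).le
  have hpΩ := closedBall_subset ho hne hx hp
  have hsub : ∀ c : ℝ, Filter.Tendsto (fun k => ENNReal.ofReal (c + ε (φ k))) Filter.atTop
      (nhds (ENNReal.ofReal c)) := fun c => by
    simpa using ENNReal.tendsto_ofReal ((hε.comp hφ.tendsto_atTop).const_add c)
  refine ⟨p, hpΩ, qhDist_le_of_tendsto ho hne hpΩ hlim (hsub s)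
    (.of_forall fun k => (hux (φ k)).le), ?_⟩
  rw [qhDist_comm]
  exact qhDist_le_of_tendsto ho hne hpΩ hlim (hsub t)
    (.of_forall fun k => by rw [qhDist_comm]; exact (huy (φ k)).le)

/-- Strict convexity about both `x` and `y` makes the Euclidean midpoint of `p ≠ q` strictly closer
to each end, so the triangle inequality fails there. Only `s` and `t` serve as radii, and each is at
most `1/50`. -/
lemma eq_of_between (ho : IsOpen Ω) (hne : (frontier Ω).Nonempty) (hx : x ∈ Ω) (hy : y ∈ Ω)
    {s t : ℝ} (hs : 0 ≤ s) (ht : 0 ≤ t) (hst : s + t ≤ 1 / 50)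
    (h : qhDist Ω x y = ENNReal.ofReal (s + t))
    (hxp : qhDist Ω x p ≤ ENNReal.ofReal s) (hpy : qhDist Ω p y ≤ ENNReal.ofReal t)
    (hxq : qhDist Ω x q ≤ ENNReal.ofReal s) (hqy : qhDist Ω q y ≤ ENNReal.ofReal t) : p = q := by
  rcases hs.eq_or_lt with rfl | hs0
  · rw [ENNReal.ofReal_zero, nonpos_iff_eq_zero] at hxp hxq
    exact (qhDist_eq_zero ho hne hxp).symm.trans (qhDist_eq_zero ho hne hxq)
  rcases ht.eq_or_lt with rfl | ht0
  · rw [ENNReal.ofReal_zero, nonpos_iff_eq_zero] at hpy hqy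
    exact (qhDist_eq_zero ho hne hpy).trans (qhDist_eq_zero ho hne hqy).symm
  by_contra hpq
  rw [qhDist_comm] at hpy hqy
  have h1 := qhDist_convexComb_lt ho hne hx (l := 1 / 2) hs0 (by linarith) (by norm_num)
    (by norm_num) hpq hxp hxq
  have h2 := qhDist_convexComb_lt ho hne hy (l := 1 / 2) ht0 (by linarith) (by norm_num)
    (by norm_num) hpq hpy hqy
  rw [qhDist_comm] at h2
  have h3 := (qhDist_triangle _ _ _).trans_lt (ENNReal.add_lt_add h1 h2)
  rw [h, ENNReal.ofReal_add hs ht] at h3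
  exact h3.false

/-- A short piece of a curve that is `1`-Lipschitz for the quasihyperbolic distance. -/
lemma qhLength_le_of_short (ho : IsOpen Ω) (hne : (frontier Ω).Nonempty)
    {γ : ℝ → EuclideanSpace ℝ (Fin n)} {u v h : ℝ} (huv : u ≤ v) (hh : h = v - u)
    (hsmall : h ≤ 1 / 50) (hm : MapsTo γ (Icc u v) Ω)
    (hγ : ∀ s t, u ≤ s → s ≤ t → t ≤ v → qhDist Ω (γ s) (γ t) ≤ ENNReal.ofReal (t - s)) :
    IsRectifiableCurve Ω γ u v (γ u) (γ v) ∧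
      qhLength Ω γ u v ≤
        ENNReal.ofReal (h * ((1 + h * (1 + h)) * (1 + h) / (1 - h * (1 + h)))) := by
  set d := Metric.infDist (γ u) (frontier Ω) with hd
  have hu : u ∈ Icc u v := left_mem_Icc.2 huv
  have hd0 : 0 < d := infDist_frontier_pos ho hne (hm hu)
  have hh0 : 0 ≤ h := by linarith
  have hk : h * (1 + h) < 1 := by nlinarith
  have hk0 : 0 ≤ h * (1 + h) := by positivity
  have hdist : ∀ s t, u ≤ s → s ≤ t → t ≤ v →
      dist (γ s) (γ t) ≤ Metric.infDist (γ s) (frontier Ω) * ((1 + h) * (t - s)) := by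
    intro s t hs hst ht
    have hts : 0 ≤ t - s := by linarith
    refine (dist_le_of_qhDist_le ho hne (hm ⟨hs, hst.trans ht⟩) hts (hγ s t hs hst ht)).trans
      (mul_le_mul_of_nonneg_left ?_ Metric.infDist_nonneg)
    refine (exp_sub_one_le hts (by linarith)).trans ?_
    rw [mul_comm]
    gcongr
    linarith
  have hfar : ∀ w ∈ Icc u v, dist (γ u) (γ w) ≤ d * (h * (1 + h)) := by
    intro w hw
    refine (hdist u w le_rfl hw.1 hw.2).trans ?_
    rw [mul_comm h]
    have : w - u ≤ h := by linarith [hw.2]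
    gcongr
  have hupp : ∀ w ∈ Icc u v, Metric.infDist (γ w) (frontier Ω) ≤ d * (1 + h * (1 + h)) := by
    intro w hw
    linarith [infDist_frontier_le_add (Ω := Ω) (γ u) (γ w), hfar w hw]
  have hlow : ∀ w ∈ Icc u v, d * (1 - h * (1 + h)) ≤ Metric.infDist (γ w) (frontier Ω) := by
    intro w hw
    have := infDist_frontier_le_add (Ω := Ω) (γ w) (γ u)
    rw [dist_comm] at this
    linarith [hfar w hw]
  -- An upper bound for the boundary distance on the piece, times the error `1 + h` of the
  -- exponential.
  set K : ℝ := d * (1 + h * (1 + h)) * (1 + h) with hK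
  have hK0 : 0 ≤ K := by positivity
  have hlip : LipschitzOnWith K.toNNReal γ (Icc u v) := by
    refine LipschitzOnWith.of_dist_le_mul fun s hs t ht => ?_
    rw [Real.coe_toNNReal _ hK0]
    wlog hst : s ≤ t generalizing s t
    · rw [dist_comm, dist_comm s]
      exact this t ht s hs (le_of_not_ge hst)
    refine (hdist s t hs.1 hst ht.2).trans ?_
    have hts : 0 ≤ t - s := by linarith
    rw [dist_comm s, Real.dist_eq, abs_of_nonneg hts, hK, mul_assoc _ (1 + h)]
    gcongr
    exact hupp s hs
  have hvar := eVariationOn_Icc_le_of_lipschitzOnWith hlip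
  rw [Real.coe_toNNReal _ hK0, ← hh] at hvar
  have hcurve : IsRectifiableCurve Ω γ u v (γ u) (γ v) :=
    ⟨huv, hlip.continuousOn, ne_top_of_le_ne_top ENNReal.ofReal_ne_top hvar, hm, rfl, rfl⟩
  have hpos : 0 < 1 - h * (1 + h) := by linarith
  refine ⟨hcurve, (qhLength_le huv hcurve.continuousOn hcurve.rectifiable (mul_pos hd0 hpos)
    hlow).trans (ENNReal.ofReal_le_ofReal ?_)⟩
  calc _ ≤ K * h / (d * (1 - h * (1 + h))) := by
        gcongr
        exact ENNReal.toReal_le_of_le_ofReal (by positivity) hvar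
    _ = _ := by
        rw [hK]
        field_simp

/-- The bound for short pieces has a relative error that tends to `0` with their size, so summing
over ever finer equal subdivisions gives the sharp constant. -/
lemma qhLength_le_of_qhDist_le (ho : IsOpen Ω) (hne : (frontier Ω).Nonempty)
    {γ : ℝ → EuclideanSpace ℝ (Fin n)} {a b : ℝ} (hab : a ≤ b) (hsmall : b - a ≤ 1 / 50)
    (hm : MapsTo γ (Icc a b) Ω)
    (hγ : ∀ s t, a ≤ s → s ≤ t → t ≤ b → qhDist Ω (γ s) (γ t) ≤ ENNReal.ofReal (t - s)) :
    qhLength Ω γ a b ≤ ENNReal.ofReal (b - a) := by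
  have hcurve := (qhLength_le_of_short ho hne hab rfl hsmall hm hγ).1
  set c : ℝ → ℝ := fun h => (1 + h * (1 + h)) * (1 + h) / (1 - h * (1 + h)) with hc
  have hstep : ∀ N : ℕ, qhLength Ω γ a b ≤
      ENNReal.ofReal ((b - a) * c ((b - a) / ((N : ℝ) + 1))) := by
    intro N
    have hN : (0 : ℝ) < N + 1 := by positivity
    have hba : 0 ≤ b - a := sub_nonneg.2 hab
    set h := (b - a) / ((N : ℝ) + 1) with hh
    have hh0 : 0 ≤ h := by positivity
    have hNh : (N + 1) * h = b - a := by rw [hh]; field_simp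
    have hh1 : h ≤ 1 / 50 := by
      have : 0 ≤ N * h := by positivity
      linarith
    have hc0 : 0 ≤ h * c h := by
      have : 0 < 1 - h * (1 + h) := by nlinarith
      positivity
    have key : ∀ k : ℕ, k ≤ N + 1 →
        qhLength Ω γ a (a + k * h) ≤ ENNReal.ofReal (k * (h * c h)) := by
      intro k
      induction k with
      | zero => intro _; simp [qhLength_self]
      | succ k ih =>
        intro hk
        have hk' : ((k : ℝ) + 1) * h ≤ b - a := by
          rw [← hNh]
          gcongr
          exact_mod_cast Nat.le_of_succ_le_succ hk
        have hkh : 0 ≤ k * h := by positivity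
        have h1 : a + (k + 1) * h ≤ b := by linarith
        have h2 : a + k * h ≤ a + (k + 1) * h := by linarith
        have h3 : a ≤ a + k * h := by linarith
        push_cast
        rw [(hcurve.restrict le_rfl (h3.trans h2) h1).qhLength_add h3 h2,
          add_one_mul _ (h * c h), ENNReal.ofReal_add (by positivity) hc0]
        refine add_le_add (ih (by omega)) ?_
        exact (qhLength_le_of_short ho hne h2 (by ring) hh1
          (hm.mono_left (Icc_subset_Icc h3 h1)) fun s t hs hst ht =>
            hγ s t (h3.trans hs) hst (ht.trans h1)).2
    have := key (N + 1) le_rfl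
    push_cast at this
    rwa [← mul_assoc, hNh, add_sub_cancel] at this
  have hlim : Filter.Tendsto (fun N : ℕ => (b - a) / ((N : ℝ) + 1)) Filter.atTop (nhds 0) := by
    simpa [div_eq_mul_inv] using tendsto_one_div_add_atTop_nhds_zero_nat.const_mul (b - a)
  have hcont : ContinuousAt (fun h => ENNReal.ofReal ((b - a) * c h)) 0 := by
    refine ENNReal.continuous_ofReal.continuousAt.comp (continuousAt_const.mul
      (ContinuousAt.div ?_ ?_ (by simp))) <;> fun_prop
  have := hcont.tendsto.comp hlim
  simp only [hc, add_zero, mul_one, sub_zero, div_one] at this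
  exact ge_of_tendsto' this hstep

lemma exists_canonicalGeodesic (ho : IsOpen Ω) (hne : (frontier Ω).Nonempty) (hx : x ∈ Ω)
    (hy : y ∈ Ω) (hxy : qhDist Ω x y < ENNReal.ofReal (1 / 50)) :
    ∃ γ₀ : ℝ → EuclideanSpace ℝ (Fin n), IsCanonicalGeodesic Ω γ₀ x y ∧
      ∀ s ∈ Icc 0 (qhDist Ω x y).toReal, qhDist Ω x (γ₀ s) ≤ ENNReal.ofReal s ∧
        qhDist Ω (γ₀ s) y ≤ ENNReal.ofReal ((qhDist Ω x y).toReal - s) := by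
  set L := (qhDist Ω x y).toReal with hLdef
  have hL : qhDist Ω x y = ENNReal.ofReal L :=
    (ENNReal.ofReal_toReal (hxy.trans ENNReal.ofReal_lt_top).ne).symm
  have hL0 : 0 ≤ L := ENNReal.toReal_nonneg
  have hL1 : L < 1 / 50 := by
    rw [hL] at hxy
    exact (ENNReal.ofReal_lt_ofReal_iff (by norm_num)).1 hxy
  have hex : ∀ s ∈ Icc 0 L, ∃ p ∈ Ω, qhDist Ω x p ≤ ENNReal.ofReal s ∧
      qhDist Ω p y ≤ ENNReal.ofReal (L - s) := fun s hs =>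
    exists_between ho hne hx hs.1 (sub_nonneg.2 hs.2) (by linarith) (by simp [hL])
  choose! γ₀ hγΩ hγx hγy using hex
  have hdist : ∀ s t, 0 ≤ s → s ≤ t → t ≤ L →
      qhDist Ω (γ₀ s) (γ₀ t) ≤ ENNReal.ofReal (t - s) := by
    intro s t hs hst ht
    have hsI : s ∈ Icc 0 L := ⟨hs, hst.trans ht⟩
    have htI : t ∈ Icc 0 L := ⟨hs.trans hst, ht⟩
    -- The points `γ₀ s` were chosen independently. A point dividing the distance from `x` to `γ₀ t`
    -- also divides that from `x` to `y`, so uniqueness identifies it with `γ₀ s`.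
    obtain ⟨p, hp, hxp, hpt⟩ := exists_between ho hne hx hs (sub_nonneg.2 hst) (by linarith)
      (y := γ₀ t) (by simpa using hγx t htI)
    have hpy : qhDist Ω p y ≤ ENNReal.ofReal (L - s) := by
      refine (qhDist_triangle p (γ₀ t) y).trans ((add_le_add hpt (hγy t htI)).trans_eq ?_)
      rw [← ENNReal.ofReal_add (by linarith) (by linarith)]
      congr 1; ring
    rwa [eq_of_between ho hne hx hy hs (sub_nonneg.2 hsI.2) (by linarith) (by simp [hL])
      (hγx s hsI) (hγy s hsI) hxp hpy]
  have hstart : γ₀ 0 = x := by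
    have := hγx 0 (left_mem_Icc.2 hL0)
    rw [ENNReal.ofReal_zero, nonpos_iff_eq_zero] at this
    exact (qhDist_eq_zero ho hne this).symm
  have hend : γ₀ L = y := by
    have := hγy L (right_mem_Icc.2 hL0)
    rw [sub_self, ENNReal.ofReal_zero, nonpos_iff_eq_zero] at this
    exact qhDist_eq_zero ho hne this
  have hcurve : IsRectifiableCurve Ω γ₀ 0 L x y := by
    have := (qhLength_le_of_short ho hne hL0 rfl (by linarith) (fun s hs => hγΩ s hs) hdist).1
    rwa [hstart, hend] at this
  have hlen : ∀ s t : ℝ, 0 ≤ s → s ≤ t → t ≤ L →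
      qhLength Ω γ₀ s t = ENNReal.ofReal (t - s) := by
    intro s t hs hst ht
    refine le_antisymm (qhLength_le_of_qhDist_le ho hne hst (by linarith)
      (hcurve.restrict hs hst ht).mapsTo fun s' t' hs' hst' ht' =>
        hdist s' t' (hs.trans hs') hst' (ht'.trans ht)) ?_
    refine le_trans ?_ (hcurve.restrict hs hst ht).qhDist_le
    -- A shortfall between `γ₀ s` and `γ₀ t` would give a path through them from `x` to `y` shorter
    -- than `L`.
    by_contra! hlt
    have hsI : s ∈ Icc 0 L := ⟨hs, hst.trans ht⟩
    have htI : t ∈ Icc 0 L := ⟨hs.trans hst, ht⟩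
    have h1 : qhDist Ω x y < ENNReal.ofReal s + ENNReal.ofReal (t - s) +
        ENNReal.ofReal (L - t) :=
      ((qhDist_triangle x (γ₀ t) y).trans (add_le_add (qhDist_triangle x (γ₀ s) (γ₀ t))
        (hγy t htI))).trans_lt (ENNReal.add_lt_add_of_lt_of_le ENNReal.ofReal_ne_top
          (ENNReal.add_lt_add_of_le_of_lt
            (ne_top_of_le_ne_top ENNReal.ofReal_ne_top (hγx s hsI)) (hγx s hsI) hlt) le_rfl)
    rw [hL, ← ENNReal.ofReal_add hs (by linarith),
      ← ENNReal.ofReal_add (by linarith) (by linarith)] at h1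
    simp at h1
  refine ⟨γ₀, ⟨⟨hcurve, ?_⟩, hlen⟩, fun s hs => ⟨hγx s hs, hγy s hs⟩⟩
  rw [← hLdef, hlen 0 L le_rfl hL0 le_rfl, sub_zero, hL]

lemma IsGeodesic.isReparametrization (ho : IsOpen Ω) (hne : (frontier Ω).Nonempty)
    (hxy : qhDist Ω x y < ENNReal.ofReal (1 / 50)) {γ γ₀ : ℝ → EuclideanSpace ℝ (Fin n)} {a b : ℝ}
    (hγ₀ : ∀ s ∈ Icc 0 (qhDist Ω x y).toReal, qhDist Ω x (γ₀ s) ≤ ENNReal.ofReal s ∧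
      qhDist Ω (γ₀ s) y ≤ ENNReal.ofReal ((qhDist Ω x y).toReal - s))
    (hγ : IsGeodesic Ω γ a b x y) :
    IsReparametrization γ a b γ₀ (qhDist Ω x y).toReal := by
  obtain ⟨hc, hlen⟩ := hγ
  set L := (qhDist Ω x y).toReal with hLdef
  have hL : qhDist Ω x y = ENNReal.ofReal L :=
    (ENNReal.ofReal_toReal (hxy.trans ENNReal.ofReal_lt_top).ne).symm
  have hL1 : L < 1 / 50 := by
    rw [hL] at hxy
    exact (ENNReal.ofReal_lt_ofReal_iff (by norm_num)).1 hxy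
  -- The change of parameter is the quasihyperbolic length run through so far; `γ t` then divides
  -- the distance in the same way as `γ₀` at that parameter.
  refine ⟨fun t => (qhLength Ω γ a t).toReal, hc.continuousOn_toReal_qhLength ho hne,
    hc.monotoneOn_toReal_qhLength ho hne, by simp [qhLength_self],
    by simp only [hlen, hLdef], fun t ht => ?_⟩
  have hadd := hc.toReal_qhLength_add ho hne ht.1 ht.2 le_rfl
  rw [hlen, ← hLdef] at hadd
  have c1 := hc.restrict le_rfl ht.1 ht.2
  have c2 := hc.restrict ht.1 ht.2 le_rfl
  have d1 := c1.qhDist_le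
  have d2 := c2.qhDist_le
  rw [hc.left] at d1
  rw [hc.right] at d2
  set s := (qhLength Ω γ a t).toReal with hs
  have hs0 : 0 ≤ s := ENNReal.toReal_nonneg
  have hs1 : (qhLength Ω γ t b).toReal = L - s := by linarith
  have hLs : 0 ≤ L - s := hs1 ▸ ENNReal.toReal_nonneg
  rw [← ENNReal.ofReal_toReal (c1.qhLength_ne_top ho hne), ← hs] at d1
  rw [← ENNReal.ofReal_toReal (c2.qhLength_ne_top ho hne), hs1] at d2
  obtain ⟨e1, e2⟩ := hγ₀ s ⟨hs0, by linarith⟩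
  exact eq_of_between ho hne hc.left_mem hc.right_mem hs0 hLs (by linarith) (by simp [hL])
    d1 d2 e1 e2

end Geodesics

end Quasihyperbolic

/-! ### The main theorem -/

theorem theorem1p1 {n : ℕ} (Ω : Set (EuclideanSpace ℝ (Fin n)))
    (hΩ : Quasihyperbolic.IsDomainSet Ω) (hΩ' : Ω ≠ Set.univ) :
    (∀ x ∈ Ω, ∀ r : ℝ, 0 < r → r ≤ 1 / 100 →
      Quasihyperbolic.IsStrictlyConvex (Quasihyperbolic.qhBall Ω x r) ∧
      Quasihyperbolic.IsStrictlyConvex (Quasihyperbolic.qhClosedBall Ω x r)) ∧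
    (∀ x ∈ Ω, ∀ y ∈ Ω, Quasihyperbolic.qhDist Ω x y < ENNReal.ofReal (1 / 50) →
      ∃ γ₀ : ℝ → EuclideanSpace ℝ (Fin n),
        Quasihyperbolic.IsCanonicalGeodesic Ω γ₀ x y ∧
        ∀ (γ : ℝ → EuclideanSpace ℝ (Fin n)) (a b : ℝ),
          Quasihyperbolic.IsGeodesic Ω γ a b x y →
            Quasihyperbolic.IsReparametrization γ a b γ₀
              (Quasihyperbolic.qhDist Ω x y).toReal) := by
  obtain ⟨ho, hconn⟩ := hΩ
  have hne : (frontier Ω).Nonempty := nonempty_frontier_iff.2 ⟨hconn.nonempty, hΩ'⟩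
  refine ⟨fun x hx r h0 hr => ?_, fun x hx y hy hxy => ?_⟩
  · have hsub := Quasihyperbolic.qhBall_subset_qhClosedBall (Ω := Ω) (x := x) r
    exact ⟨Quasihyperbolic.isStrictlyConvex_of_subset ho hne hx h0 (by linarith) subset_rfl hsub,
      Quasihyperbolic.isStrictlyConvex_of_subset ho hne hx h0 (by linarith) hsub subset_rfl⟩
  · obtain ⟨γ₀, hcan, hγ₀⟩ := Quasihyperbolic.exists_canonicalGeodesic ho hne hx hy hxy
    exact ⟨γ₀, hcan, fun γ a b hγ => hγ.isReparametrization ho hne hxy hγ₀⟩
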